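/- **Setting.** Let $N,K,T$ be natural numbers with $NT\ge 3^{11}$, let $G$ be an undirected graph on the arms $[N]$, and let $V_1,\dots,V_K$ be a clique covering of $G$, i.e. a partition of $[N]$ into $K$ nonempty cliques of $G$ (for instance a minimum one, with $K=\theta(G)$). Write $V(i)$ for the part containing $i$ and $p(A)=\sum_{i\in A}p_i$. *Losses.* Integrable random vectors $\tilde\ell_1,\dots,\tilde\ell_T\in\mathbb R^N$ are drawn i.i.d. with mean vector $\mu$, where $\mu$ has a unique minimizer $i^\star$, i.e. $\mu_{i^\star}<\mu_i$ for all $i\ne i^\star$; let $V_{k^\star}=V(i^\star)$. An adversary replaces them by arbitrary random loss vectors $\ell_1,\dots,\ell_T\in[0,1]^N$; nothing is assumed about the corruption level $\mathbb E\big[\sum_{t=1}^T\|\ell_t-\tilde\ell_t\|_\infty\big]$. The vector $\ell_t$ may depend on $I_1,\dots,I_{t-1}$ but not on the random draw of $I_t$. *Algorithm 1.* Put $\alpha=2(\log^2(NT)+1)$, $\gamma=1/(NT)$, $\eta_t=1/\sqrt t$, $\mathcal S_N^\gamma=\{p\in\mathbb R^N_{\ge0}:\sum_i p_i=1,\ p_i\ge\gamma\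 \forall i\}$, and $$\Psi(p)=-\alpha\sum_{k=1}^K\sqrt{p(V_k)}+\sum_{k=1}^K\frac1{\sqrt{p(V_k)}}\sum_{i\in V_k}p_i\log\frac{p_i}{p(V_k)},\qquad \Phi(p)=-9\sum_{k=1}^K\log p(V_k),\qquad R_t=\eta_t^{-1}\Psi+\Phi .$$ Starting from $\widehat L_0=0$, in each round $t=1,\dots,T$ the algorithm computes $p_t=\operatorname{arg\,min}_{p\in\mathcal S_N^\gamma}\{\widehat L_{t-1}\cdot p+R_t(p)\}$, draws $I_t$ from $p_t$ (that is, conditionally on $I_1,\dots,I_{t-1}$ and $\ell_1,\dots,\ell_t$, the arm $I_t$ has law $p_t$), observes the losses $\ell_{t,i}$ of $I_t$ and its neighbours in $G$, sets $\widehat\ell_{t,i}=\frac{\ell_{t,i}}{p_t(V(i))}\mathbb I\{i\in V(I_t)\}$ for all $i$, and $\widehat L_t=\widehat L_{t-1}+\widehat\ell_t$. Let also $p_t^+=\operatorname{arg\,min}_{p\in\mathcal S_N^\gamma}\{\widehat L_t\cdot p+R_t(p)\}$. **Theorem.** The pseudo-regret $\mathcal R_T=\mathbb E\big[\sum_{t=1}^T\ell_{t,I_t}\big]-\min_{i\in[N]}\mathbb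 E\big[\sum_{t=1}^T\ell_{t,i}\big]$ satisfies, regardless of the corruption level, $$\mathcal R_T\le 9K\log(NT)+6\log^2(NT)\sum_{t=1}^T\sum_{k\ne k^\star}\sqrt{\frac{\mathbb E[p_t(V_k)]}{t}}+2\log(NT)\sum_{t=1}^T\sqrt{\frac{\mathbb E[p_t(V_{k^\star}\setminus\{i^\star\})]}{t}}+16\sum_{t=1}^T\sqrt{\frac{\mathbb E[p_t^+(V_{k^\star}\setminus\{i^\star\})]}{t}} .$$ -/

import Mathlib

open MeasureTheory ProbabilityTheory

namespace GraphFTRL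

noncomputable section

/-- `p(A) = ∑_{i ∈ A} p_i`. -/
def mass {N : ℕ} (p : Fin N → ℝ) (A : Finset (Fin N)) : ℝ := ∑ i ∈ A, p i

/-- A partition of the arms into `K` labelled parts is given by the map `c` sending an arm to
the label of its part; `cell c k` is the part `V_k`, and `cell c (c i)` is `V(i)`. -/
def cell {N K : ℕ} (c : Fin N → Fin K) (k : Fin K) : Finset (Fin N) :=
  Finset.univ.filter fun i => c i = k

/-- The parts `V_1, …, V_K` of `c` form a clique covering of the graph `G`: a partition of the
vertices into nonempty cliques. -/
structure IsCliqueCovering {N K : ℕ} (G : SimpleGraph (Fin N)) (c : Fin N → Fin K) : Prop where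
  nonempty : ∀ k, (cell c k).Nonempty
  isClique : ∀ k, G.IsClique (cell c k : Set (Fin N))

/-- The Tsallis-Shannon entropy
`Ψ(p) = -α ∑_k √(p(V_k)) + ∑_k 1/√(p(V_k)) ∑_{i ∈ V_k} p_i log (p_i / p(V_k))`. -/
def tsallisShannon {N K : ℕ} (α : ℝ) (c : Fin N → Fin K) (p : Fin N → ℝ) : ℝ :=
  -α * ∑ k, √(mass p (cell c k)) +
    ∑ k, 1 / √(mass p (cell c k)) *
      ∑ i ∈ cell c k, p i * Real.log (p i / mass p (cell c k))

/-- The log-barrier of the clique marginals, `Φ(p) = -β ∑_k log p(V_k)`. -/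
def logBarrier {N K : ℕ} (β : ℝ) (c : Fin N → Fin K) (p : Fin N → ℝ) : ℝ :=
  -β * ∑ k, Real.log (mass p (cell c k))

/-- The truncated simplex: probability vectors all of whose entries are at least `γ`. -/
def truncatedSimplex (N : ℕ) (γ : ℝ) : Set (Fin N → ℝ) :=
  {p | (∀ i, 0 ≤ p i) ∧ ∑ i, p i = 1 ∧ ∀ i, γ ≤ p i}

/-- `α = 2 (log² (N T) + 1)`. -/
def alphaParam (N T : ℕ) : ℝ := 2 * (Real.log ((N : ℝ) * T) ^ 2 + 1)

/-- `γ = 1 / (N T)`. -/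
def gammaParam (N T : ℕ) : ℝ := 1 / ((N : ℝ) * T)

/-- `η_t = 1 / √t`. -/
def stepSize (t : ℕ) : ℝ := 1 / √(t : ℝ)

/-- `R_t = η_t⁻¹ Ψ + Φ` with `β = 9`, for horizon `T`. -/
def regularizer {N K : ℕ} (T : ℕ) (c : Fin N → Fin K) (t : ℕ) (p : Fin N → ℝ) : ℝ :=
  (stepSize t)⁻¹ * tsallisShannon (alphaParam N T) c p + logBarrier 9 c p

/-- The objective `p ↦ L · p + R_t(p)`. -/
def objective {N K : ℕ} (T : ℕ) (c : Fin N → Fin K) (t : ℕ) (L p : Fin N → ℝ) : ℝ :=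
  ∑ i, L i * p i + regularizer T c t p

/-- The point `argmin {L · p + R_t(p) : p ∈ truncated simplex}`. -/
def ftrlPoint {N K : ℕ} (T : ℕ) (c : Fin N → Fin K) (t : ℕ) (L : Fin N → ℝ) : Fin N → ℝ :=
  Classical.epsilon fun p =>
    p ∈ truncatedSimplex N (gammaParam N T) ∧
      IsMinOn (objective T c t L) (truncatedSimplex N (gammaParam N T)) p

/-- The loss estimator built from the prediction `p`, the loss vector `l` and the chosen arm `j`:
`l_i / p(V(i))` for `i ∈ V(j)`, and `0` for the other arms. -/
def lossEstimate {N K : ℕ} (c : Fin N → Fin K) (p l : Fin N → ℝ) (j : Fin N) : Fin N → ℝ :=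
  fun i => if i ∈ cell c (c j) then l i / mass p (cell c (c i)) else 0

/-- The cumulative estimated losses after `t` rounds of the algorithm, when `l s` is the loss
vector and `a s` the chosen arm of round `s = 1, 2, …`. -/
def cumEstimate {N K : ℕ} (T : ℕ) (c : Fin N → Fin K) (l : ℕ → Fin N → ℝ) (a : ℕ → Fin N) :
    ℕ → Fin N → ℝ
  | 0 => 0
  | t + 1 => cumEstimate T c l a t +
      lossEstimate c (ftrlPoint T c (t + 1) (cumEstimate T c l a t)) (l (t + 1)) (a (t + 1))

/-- The prediction `p_t` of the algorithm in round `t ≥ 1`. -/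
def prediction {N K : ℕ} (T : ℕ) (c : Fin N → Fin K) (l : ℕ → Fin N → ℝ) (a : ℕ → Fin N)
    (t : ℕ) : Fin N → ℝ :=
  ftrlPoint T c t (cumEstimate T c l a (t - 1))

/-- The point `p_t⁺ = argmin {L_t · p + R_t(p)}`, where `L_t` already includes the estimated
loss of round `t`. -/
def predictionPlus {N K : ℕ} (T : ℕ) (c : Fin N → Fin K) (l : ℕ → Fin N → ℝ) (a : ℕ → Fin N)
    (t : ℕ) : Fin N → ℝ :=
  ftrlPoint T c t (cumEstimate T c l a t)

/-- The adversarially corrupted stochastic environment over `T` rounds: the vectors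
`lTilde 1, …, lTilde T` are i.i.d. with mean `μ`, and the final loss vectors `l 1, …, l T` are
arbitrary random vectors with values in `[0,1]^N`. -/
structure IsCorruptedStochastic {Ω : Type*} [MeasurableSpace Ω] {N : ℕ} (P : Measure Ω) (T : ℕ)
    (lTilde l : ℕ → Ω → Fin N → ℝ) (μ : Fin N → ℝ) : Prop where
  measurable_tilde : ∀ t ∈ Finset.Icc 1 T, Measurable (lTilde t)
  indep : iIndepFun (fun (t : Finset.Icc 1 T) => lTilde t) P
  identDistrib : ∀ s ∈ Finset.Icc 1 T, ∀ t ∈ Finset.Icc 1 T,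
    IdentDistrib (lTilde s) (lTilde t) P P
  integrable_tilde : ∀ t ∈ Finset.Icc 1 T, ∀ i, Integrable (fun ω => lTilde t ω i) P
  mean : ∀ t ∈ Finset.Icc 1 T, ∀ i, ∫ ω, lTilde t ω i ∂P = μ i
  measurable : ∀ t ∈ Finset.Icc 1 T, Measurable (l t)
  mem_Icc : ∀ t ∈ Finset.Icc 1 T, ∀ ω i, l t ω i ∈ Set.Icc (0 : ℝ) 1

/-- The information available right before the arm of round `t` is drawn: the arms of rounds
`1, …, t - 1` and the loss vectors of rounds `1, …, t`. -/
@[reducible] def history {Ω : Type*} {N : ℕ} (l : ℕ → Ω → Fin N → ℝ) (I : ℕ → Ω → Fin N) (t : ℕ) :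
    MeasurableSpace Ω :=
  (⨆ s ∈ Set.Ico 1 t, MeasurableSpace.comap (I s) inferInstance) ⊔
    (⨆ s ∈ Set.Icc 1 t, MeasurableSpace.comap (l s) inferInstance)

/-- The arms `I 1, …, I T` are those played by the algorithm on the losses `l`: given the
history, the arm of round `t` is drawn from `p_t`. The losses may depend on past arms, not on
the current draw. -/
structure IsPlayedBy {Ω : Type*} [MeasurableSpace Ω] {N K : ℕ} (P : Measure Ω) (T : ℕ)
    (c : Fin N → Fin K) (l : ℕ → Ω → Fin N → ℝ) (I : ℕ → Ω → Fin N) : Prop where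
  measurable : ∀ t ∈ Finset.Icc 1 T, Measurable (I t)
  condLaw : ∀ t ∈ Finset.Icc 1 T, ∀ i,
    P[Set.indicator {ω | I t ω = i} (fun _ => (1 : ℝ)) | history l I t] =ᵐ[P]
      fun ω => prediction T c (fun s => l s ω) (fun s => I s ω) t i

/-- The pseudo-regret `E[∑_t l_{t, I_t}] - min_i E[∑_t l_{t, i}]`. -/
def pseudoRegret {Ω : Type*} [MeasurableSpace Ω] {N : ℕ} (P : Measure Ω) (T : ℕ)
    (l : ℕ → Ω → Fin N → ℝ) (I : ℕ → Ω → Fin N) : ℝ :=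
  (∫ ω, ∑ t ∈ Finset.Icc 1 T, l t ω (I t ω) ∂P) -
    ⨅ i : Fin N, ∫ ω, ∑ t ∈ Finset.Icc 1 T, l t ω i ∂P

/-- The loss estimator only uses observed losses: those of the chosen arm and its neighbours. -/
theorem lossEstimate_congr {N K : ℕ} {G : SimpleGraph (Fin N)} {c : Fin N → Fin K}
    (hc : IsCliqueCovering G c) (p l l' : Fin N → ℝ) (j : Fin N)
    (h : ∀ i, i = j ∨ G.Adj j i → l i = l' i) :
    lossEstimate c p l j = lossEstimate c p l' j := by
  funext i
  unfold lossEstimate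
  split_ifs with hi
  · have : i = j ∨ G.Adj j i := by
      by_cases hij : i = j
      · exact Or.inl hij
      · refine Or.inr (hc.isClique (c j) ?_ ?_ (Ne.symm hij))
        · simp [cell]
        · exact_mod_cast hi
    rw [h i this]
  · rfl

/-- The minimum defining `ftrlPoint` is attained. -/
theorem ftrlPoint_spec {N K : ℕ} {G : SimpleGraph (Fin N)} {c : Fin N → Fin K}
    (hc : IsCliqueCovering G c) {T : ℕ} (hN : 0 < N) (hT : 0 < T) (t : ℕ) (L : Fin N → ℝ) :
    ftrlPoint T c t L ∈ truncatedSimplex N (gammaParam N T) ∧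
      IsMinOn (objective T c t L) (truncatedSimplex N (gammaParam N T)) (ftrlPoint T c t L) := by
  have hN' : (0 : ℝ) < N := by exact_mod_cast hN
  have hT' : (0 : ℝ) < T := by exact_mod_cast hT
  have hγ : 0 < gammaParam N T := by unfold gammaParam; positivity
  have hmass : ∀ k, Continuous fun p : Fin N → ℝ => mass p (cell c k) := by
    intro k; unfold mass; fun_prop
  have hpos : ∀ k, ∀ p ∈ truncatedSimplex N (gammaParam N T), 0 < mass p (cell c k) := by
    intro k p hp
    exact Finset.sum_pos (fun i _ => hγ.trans_le (hp.2.2 i)) (hc.nonempty k)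
  have hcomp : IsCompact (truncatedSimplex N (gammaParam N T)) := by
    refine (isCompact_stdSimplex ℝ (Fin N)).of_isClosed_subset ?_ (fun p hp => ⟨hp.1, hp.2.1⟩)
    have h1 : IsClosed {p : Fin N → ℝ | ∀ i, 0 ≤ p i} := by
      simp only [Set.ofPred_forall]
      exact isClosed_iInter fun i => isClosed_le continuous_const (continuous_apply i)
    have h2 : IsClosed {p : Fin N → ℝ | ∑ i, p i = 1} :=
      isClosed_eq (by fun_prop) continuous_const
    have h3 : IsClosed {p : Fin N → ℝ | ∀ i, gammaParam N T ≤ p i} := by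
      simp only [Set.ofPred_forall]
      exact isClosed_iInter fun i => isClosed_le continuous_const (continuous_apply i)
    exact h1.inter (h2.inter h3)
  have hne : (truncatedSimplex N (gammaParam N T)).Nonempty := by
    refine ⟨fun _ => 1 / N, fun i => by positivity, ?_, fun i => ?_⟩
    · simp [hN'.ne']
    · unfold gammaParam
      have : (1 : ℝ) ≤ T := by exact_mod_cast hT
      exact one_div_le_one_div_of_le hN' (by nlinarith)
  have hcont : ContinuousOn (objective T c t L) (truncatedSimplex N (gammaParam N T)) := by
    have hq : ∀ k, ContinuousOn (fun p : Fin N → ℝ => mass p (cell c k))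
        (truncatedSimplex N (gammaParam N T)) := fun k => (hmass k).continuousOn
    have hp : ∀ i : Fin N, ContinuousOn (fun p : Fin N → ℝ => p i)
        (truncatedSimplex N (gammaParam N T)) := fun i => (continuous_apply i).continuousOn
    unfold objective regularizer tsallisShannon logBarrier
    refine ContinuousOn.add (continuousOn_finsetSum _ fun i _ => continuousOn_const.mul (hp i)) ?_
    refine ContinuousOn.add (continuousOn_const.mul (ContinuousOn.add
      (continuousOn_const.mul (continuousOn_finsetSum _ fun k _ => (hq k).sqrt))
      (continuousOn_finsetSum _ fun k _ => ContinuousOn.mul ?_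
        (continuousOn_finsetSum _ fun i _ => (hp i).mul ?_))))
      (continuousOn_const.mul (continuousOn_finsetSum _ fun k _ => ?_))
    · exact continuousOn_const.div (hq k).sqrt
        fun p h => (Real.sqrt_pos.2 (hpos k p h)).ne'
    · exact ((hp i).div (hq k) fun p h => (hpos k p h).ne').log
        fun p h => (div_pos (hγ.trans_le (h.2.2 i)) (hpos k p h)).ne'
    · exact (hq k).log fun p h => (hpos k p h).ne'
  obtain ⟨p, hp, hmin⟩ := hcomp.exists_isMinOn hne hcont
  exact Classical.epsilon_spec (p := fun p =>
    p ∈ truncatedSimplex N (gammaParam N T) ∧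
      IsMinOn (objective T c t L) (truncatedSimplex N (gammaParam N T)) p) ⟨p, hp, hmin⟩

end

end GraphFTRL

/-!
The bound holds with an arbitrary arm `iStar`, for every adaptive loss sequence and against every
competing arm. It is the analysis of follow-the-regularized-leader on the importance-weighted
losses, carried out along each sample path and then averaged.

*Geometry of the regularizer.* Write `s = √p(V)` for a clique `V` and `q = p / p(V)` for the
conditional distribution on it. The contribution of `V` to `Ψ` is `-s (α + H(q))` with `H` the
Shannon entropy, and its Bregman divergence from `p` to `p'` is exactly
`((α + H(q)) (s' - s)² / 2 + s'² KL(q' ‖ q) + s' (s' - s) (H(q') - H(q))) / s`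
(`bregman_cliqueEntropy`). On the truncated simplex two entropies differ by at most `L √KL` with
`L = log (N T)`, because log-probabilities oscillate by at most `L` and the total variation
distance is at most `√KL`. Hence `α = 2 (L² + 1)` makes the cross term harmless, and the
divergence controls both `(s' - s)²` and `KL(q' ‖ q)` (`le_bregman_cliqueEntropy`).

*Stability.* By first-order optimality of the prediction, moving away from it costs at least this
divergence plus that of the log-barrier (`sum_cliqueDiv_le_objective_sub`). If the drawn clique
`V` is not that of `iStar`, or is but has mass below `9 / 10`, the estimated loss, at most
`1 / p(V)` on `V`, is paid for up to `2 / √(t p(V))` (`stability_of_nonneg_loss`); the log-barrier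
is needed when the mass of `V` would at least double. If `V` is the clique of `iStar` and has mass
at least `9 / 10`, all losses are shifted by the estimated loss of `iStar`. The loss then vanishes
at `iStar`, so that inside `V` only the mass of the other arms enters
(`stability_of_loss_vanishing_at`, by Gibbs' variational bound), and elsewhere it is constant on
cliques and bounded (`stability_of_const_loss`). Averaged over the arm, the stability term is at
most `(22 ∑_{k ≠ k⋆} √p(V_k) + 8 √p(V_{k⋆} \ {iStar})) / √t` (`sum_mul_stabilityBound_le`). The
masses are evaluated at the prediction `p_t`, so the sum over the points `p_t⁺` enters only through
its nonnegativity.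

*Penalty.* `Ψ ≤ -α` everywhere, whereas `-Ψ(p_t) - α` is small when `p_t` concentrates on `iStar`
(`tsallisShannon_sub_le`); the increments of the learning-rate schedule satisfy
`√t - √(t - 1) ≤ 1 / √t`. The log-barrier at the comparator gives `9 K L`, with enough slack to
absorb the bias of a comparator inside the truncated simplex (`logBarrier_comparator_add_one_le`).

*Expectation.* The estimates are unbiased given the history (`integral_draw`,
`sum_mul_sum_lossEstimate`), and Jensen's inequality moves the expectation under the square roots.
-/

namespace GraphFTRL

/-! ### Entropy and relative entropy on a finite set -/

/-- Shannon entropy `-∑_{i ∈ V} q_i log q_i` of the weights `q` on `V`. -/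
noncomputable def entropy {N : ℕ} (V : Finset (Fin N)) (q : Fin N → ℝ) : ℝ :=
  -∑ i ∈ V, q i * Real.log (q i)

/-- Relative entropy `∑_{i ∈ V} q'_i log (q'_i / q_i)` of the weights `q'` with respect to `q`. -/
noncomputable def relEntropy {N : ℕ} (V : Finset (Fin N)) (q' q : Fin N → ℝ) : ℝ :=
  ∑ i ∈ V, q' i * Real.log (q' i / q i)

section Entropy

variable {N : ℕ} {V : Finset (Fin N)} {q q' : Fin N → ℝ}

/-- In each coordinate the squared Hellinger distance is at most the relative entropy. -/
theorem sq_sqrt_sub_sqrt_le {x y : ℝ} (hx : 0 < x) (hy : 0 < y) :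
    (√x - √y) ^ 2 ≤ x * Real.log (x / y) - x + y := by
  have hsx := Real.sqrt_pos.2 hx
  have hsy := Real.sqrt_pos.2 hy
  have h1 : Real.log (√y / √x) ≤ √y / √x - 1 := Real.log_le_sub_one_of_pos (div_pos hsy hsx)
  have h2 : Real.log (√y / √x) = -(1 / 2) * Real.log (x / y) := by
    rw [← Real.sqrt_div hy.le, Real.log_sqrt (div_pos hy hx).le, ← inv_div x y, Real.log_inv]
    ring
  rw [h2] at h1
  have h3 : x * (√y / √x) = √x * √y := by
    nth_rewrite 1 [← Real.mul_self_sqrt hx.le]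
    field_simp
  have h4 := mul_le_mul_of_nonneg_left h1 hx.le
  nlinarith [Real.sq_sqrt hx.le, Real.sq_sqrt hy.le]

theorem sum_sq_sqrt_sub_le_relEntropy (hq : ∀ i ∈ V, 0 < q i) (hq' : ∀ i ∈ V, 0 < q' i)
    (h1 : ∑ i ∈ V, q i = 1) (h1' : ∑ i ∈ V, q' i = 1) :
    ∑ i ∈ V, (√(q' i) - √(q i)) ^ 2 ≤ relEntropy V q' q := by
  calc ∑ i ∈ V, (√(q' i) - √(q i)) ^ 2
      ≤ ∑ i ∈ V, (q' i * Real.log (q' i / q i) - q' i + q i) :=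
        Finset.sum_le_sum fun i hi => sq_sqrt_sub_sqrt_le (hq' i hi) (hq i hi)
    _ = relEntropy V q' q := by
        rw [Finset.sum_add_distrib, Finset.sum_sub_distrib, h1, h1', relEntropy]; ring

theorem relEntropy_nonneg (hq : ∀ i ∈ V, 0 < q i) (hq' : ∀ i ∈ V, 0 < q' i)
    (h1 : ∑ i ∈ V, q i = 1) (h1' : ∑ i ∈ V, q' i = 1) : 0 ≤ relEntropy V q' q :=
  (Finset.sum_nonneg fun _ _ => sq_nonneg _).trans
    (sum_sq_sqrt_sub_le_relEntropy hq hq' h1 h1')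

/-- A form of Pinsker's inequality with constant `2`, obtained from the Hellinger distance. -/
theorem sum_abs_sub_le_sqrt_relEntropy (hq : ∀ i ∈ V, 0 < q i) (hq' : ∀ i ∈ V, 0 < q' i)
    (h1 : ∑ i ∈ V, q i = 1) (h1' : ∑ i ∈ V, q' i = 1) :
    ∑ i ∈ V, |q i - q' i| ≤ 2 * √(relEntropy V q' q) := by
  have hle := sum_sq_sqrt_sub_le_relEntropy hq hq' h1 h1'
  have hcs := Finset.sum_mul_sq_le_sq_mul_sq V (fun i => |√(q' i) - √(q i)|)
    (fun i => √(q' i) + √(q i))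
  have he : ∑ i ∈ V, |√(q' i) - √(q i)| * (√(q' i) + √(q i)) = ∑ i ∈ V, |q i - q' i| := by
    refine Finset.sum_congr rfl fun i hi => ?_
    have h : q i - q' i = -((√(q' i) - √(q i)) * (√(q' i) + √(q i))) := by
      nlinarith [Real.sq_sqrt (hq i hi).le, Real.sq_sqrt (hq' i hi).le]
    rw [h, abs_neg, abs_mul, abs_of_nonneg (a := √(q' i) + √(q i)) (by positivity)]
  have h4 : ∑ i ∈ V, (√(q' i) + √(q i)) ^ 2 ≤ 4 := by
    calc ∑ i ∈ V, (√(q' i) + √(q i)) ^ 2 ≤ ∑ i ∈ V, (2 * q' i + 2 * q i) := by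
          refine Finset.sum_le_sum fun i hi => ?_
          nlinarith [Real.sq_sqrt (hq i hi).le, Real.sq_sqrt (hq' i hi).le,
            sq_nonneg (√(q' i) - √(q i))]
      _ = 4 := by
          rw [Finset.sum_add_distrib, ← Finset.mul_sum, ← Finset.mul_sum, h1, h1']; norm_num
  simp only [sq_abs] at hcs
  rw [he] at hcs
  have hk := relEntropy_nonneg hq hq' h1 h1'
  have : (∑ i ∈ V, |q i - q' i|) ^ 2 ≤ 4 * relEntropy V q' q := by
    refine hcs.trans ?_
    have := mul_le_mul hle h4 (Finset.sum_nonneg fun _ _ => sq_nonneg _) hk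
    linarith
  refine abs_le_of_sq_le_sq' ?_ (by positivity) |>.2
  rw [mul_pow, Real.sq_sqrt hk]
  linarith

/-- The entropy is concave, and its gradient has oscillation at most `L` where `q ≥ exp (-L)`. -/
theorem entropy_sub_le {L : ℝ} (hq : ∀ i ∈ V, 0 < q i) (hq' : ∀ i ∈ V, 0 < q' i)
    (hL : ∀ i ∈ V, -L ≤ Real.log (q i)) (hle : ∀ i ∈ V, q i ≤ 1)
    (h1 : ∑ i ∈ V, q i = 1) (h1' : ∑ i ∈ V, q' i = 1) :
    entropy V q' - entropy V q ≤ L / 2 * ∑ i ∈ V, |q i - q' i| := by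
  have key : ∀ i ∈ V, q i * Real.log (q i) - q' i * Real.log (q' i) ≤
      L / 2 * |q i - q' i| + (1 - L / 2) * (q i - q' i) := by
    intro i hi
    have h := sq_sqrt_sub_sqrt_le (hq' i hi) (hq i hi)
    rw [Real.log_div (hq' i hi).ne' (hq i hi).ne'] at h
    have h0 : Real.log (q i) ≤ 0 := Real.log_nonpos (hq i hi).le (hle i hi)
    have h2 : (q i - q' i) * (Real.log (q i) + L / 2) ≤ |q i - q' i| * (L / 2) := by
      refine (le_abs_self _).trans ?_
      rw [abs_mul]
      exact mul_le_mul_of_nonneg_left (abs_le.2 ⟨by linarith [hL i hi], by linarith⟩)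
        (abs_nonneg _)
    nlinarith [sq_nonneg (√(q' i) - √(q i))]
  have h := Finset.sum_le_sum key
  rw [Finset.sum_sub_distrib, Finset.sum_add_distrib, ← Finset.mul_sum, ← Finset.mul_sum,
    Finset.sum_sub_distrib, h1, h1'] at h
  unfold entropy
  linarith

theorem entropy_nonneg (hq : ∀ i ∈ V, 0 < q i) (hle : ∀ i ∈ V, q i ≤ 1) : 0 ≤ entropy V q := by
  unfold entropy
  rw [neg_nonneg]
  exact Finset.sum_nonpos fun i hi =>
    mul_nonpos_of_nonneg_of_nonpos (hq i hi).le (Real.log_nonpos (hq i hi).le (hle i hi))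

theorem entropy_le {L : ℝ} (hq : ∀ i ∈ V, 0 < q i)
    (hL : ∀ i ∈ V, -L ≤ Real.log (q i)) (h1 : ∑ i ∈ V, q i = 1) : entropy V q ≤ L := by
  have : ∑ i ∈ V, q i * (-L) ≤ ∑ i ∈ V, q i * Real.log (q i) :=
    Finset.sum_le_sum fun i hi => mul_le_mul_of_nonneg_left (hL i hi) (hq i hi).le
  rw [← Finset.sum_mul, h1] at this
  unfold entropy
  linarith

/-- A distribution that puts mass `1 - x` on one point has entropy at most `(L + 1) x`. -/
theorem entropy_le_mul_sum_erase {L : ℝ} {j : Fin N} (hj : j ∈ V) (hq : ∀ i ∈ V, 0 < q i)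
    (hL : ∀ i ∈ V, -L ≤ Real.log (q i)) (h1 : ∑ i ∈ V, q i = 1) :
    entropy V q ≤ (L + 1) * ∑ i ∈ V.erase j, q i := by
  have h2 : ∑ i ∈ V.erase j, q i * (-L) ≤ ∑ i ∈ V.erase j, q i * Real.log (q i) :=
    Finset.sum_le_sum fun i hi => mul_le_mul_of_nonneg_left (hL i (Finset.mem_of_mem_erase hi))
      (hq i (Finset.mem_of_mem_erase hi)).le
  rw [← Finset.sum_mul] at h2
  have h3 : 1 - (q j)⁻¹ ≤ Real.log (q j) := Real.one_sub_inv_le_log_of_pos (hq j hj)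
  have h4 := mul_le_mul_of_nonneg_left h3 (hq j hj).le
  have h5 : q j * (1 - (q j)⁻¹) = q j - 1 := by
    have := (hq j hj).ne'
    field_simp
  have h6 := Finset.add_sum_erase V q hj
  have h7 := Finset.add_sum_erase V (fun i => q i * Real.log (q i)) hj
  unfold entropy
  rw [← h7]
  rw [h1] at h6
  linarith

end Entropy

/-! ### The contribution of one clique to the regularizer -/

/-- The summand of the Tsallis-Shannon entropy that belongs to the clique `V`. -/
noncomputable def cliqueEntropy {N : ℕ} (α : ℝ) (V : Finset (Fin N)) (p : Fin N → ℝ) : ℝ :=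
  -α * √(mass p V) + 1 / √(mass p V) * ∑ i ∈ V, p i * Real.log (p i / mass p V)

/-- The conditional distribution `p_i / p(V)` on the clique `V`. -/
noncomputable def cond {N : ℕ} (p : Fin N → ℝ) (V : Finset (Fin N)) (i : Fin N) : ℝ :=
  p i / mass p V

/-- The directional derivative of `cliqueEntropy α V` at `p` in the direction `v`. -/
noncomputable def cliqueEntropyDeriv {N : ℕ} (α : ℝ) (V : Finset (Fin N)) (p v : Fin N → ℝ) : ℝ :=
  1 / √(mass p V) * ((-α / 2 + entropy V (cond p V) / 2) * mass v V +
    ∑ i ∈ V, v i * Real.log (cond p V i))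

section Clique

variable {N : ℕ} {V : Finset (Fin N)} {p p' : Fin N → ℝ}

theorem mass_pos (hV : V.Nonempty) (hp : ∀ i ∈ V, 0 < p i) : 0 < mass p V :=
  Finset.sum_pos hp hV

theorem cond_pos (hp : ∀ i ∈ V, 0 < p i) : ∀ i ∈ V, 0 < cond p V i :=
  fun i hi => div_pos (hp i hi) (mass_pos ⟨i, hi⟩ hp)

theorem sum_cond (hV : V.Nonempty) (hp : ∀ i ∈ V, 0 < p i) : ∑ i ∈ V, cond p V i = 1 := by
  unfold cond
  rw [← Finset.sum_div]
  exact div_self (mass_pos hV hp).ne'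

theorem cond_le_one (hp : ∀ i ∈ V, 0 < p i) : ∀ i ∈ V, cond p V i ≤ 1 := fun i hi =>
  (div_le_one (mass_pos ⟨i, hi⟩ hp)).2
    (Finset.single_le_sum (f := p) (fun j hj => (hp j hj).le) hi)

theorem mul_cond (hp : ∀ i ∈ V, 0 < p i) : ∀ i ∈ V, mass p V * cond p V i = p i := fun i hi => by
  have := (mass_pos ⟨i, hi⟩ hp).ne'
  unfold cond
  field_simp

theorem sum_mul_log_div_mass (hp : ∀ i ∈ V, 0 < p i) :
    ∑ i ∈ V, p i * Real.log (p i / mass p V) = -(mass p V * entropy V (cond p V)) := by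
  unfold entropy
  rw [mul_neg, neg_neg, Finset.mul_sum]
  refine Finset.sum_congr rfl fun i hi => ?_
  rw [← mul_assoc, mul_cond hp i hi, cond]

theorem cliqueEntropy_eq (α : ℝ) (hV : V.Nonempty) (hp : ∀ i ∈ V, 0 < p i) :
    cliqueEntropy α V p = -√(mass p V) * (α + entropy V (cond p V)) := by
  have hP := mass_pos hV hp
  have hs := Real.sqrt_pos.2 hP
  have h := sum_mul_log_div_mass hp
  unfold cliqueEntropy
  rw [h]
  have h2 : 1 / √(mass p V) * mass p V = √(mass p V) := by
    nth_rewrite 2 [← Real.mul_self_sqrt hP.le]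
    field_simp
  linear_combination (-entropy V (cond p V)) * h2

theorem hasDerivAt_mass (p v : Fin N → ℝ) (V : Finset (Fin N)) :
    HasDerivAt (fun ε : ℝ => mass (p + ε • v) V) (mass v V) 0 := by
  unfold mass
  refine HasDerivAt.fun_sum fun i _ => ?_
  simpa using ((hasDerivAt_id (0 : ℝ)).mul_const (v i)).const_add (p i)

theorem hasDerivAt_cliqueEntropy (α : ℝ) (hV : V.Nonempty) (hp : ∀ i ∈ V, 0 < p i)
    (v : Fin N → ℝ) :
    HasDerivAt (fun ε : ℝ => cliqueEntropy α V (p + ε • v)) (cliqueEntropyDeriv α V p v) 0 := by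
  have hP := mass_pos hV hp
  have hs := Real.sqrt_pos.2 hP
  have h0 : p + (0 : ℝ) • v = p := by simp
  have hM := hasDerivAt_mass p v V
  have hsqrt := hM.sqrt (by simpa [h0] using hP.ne')
  have hinv := hsqrt.inv (by simpa [h0] using hs.ne')
  have hi : ∀ i ∈ V, HasDerivAt (fun ε : ℝ => (p + ε • v) i) (v i) 0 := fun i _ => by
    simpa using ((hasDerivAt_id (0 : ℝ)).mul_const (v i)).const_add (p i)
  have hsum := HasDerivAt.fun_sum (u := V) fun i hiV =>
    (hi i hiV).mul (((hi i hiV).div hM (by simpa [h0] using hP.ne')).log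
      (by simpa [h0] using (div_pos (hp i hiV) hP).ne'))
  have hall := (hsqrt.const_mul (-α)).add (hinv.mul hsum)
  unfold cliqueEntropy
  simp only [one_div]
  refine hall.congr_deriv ?_
  simp only [h0, Pi.div_apply, Pi.mul_apply, Pi.inv_apply]
  have hz : ∑ i ∈ V, (v i * Real.log (p i / mass p V) +
      p i * ((v i * mass p V - p i * mass v V) / mass p V ^ 2 / (p i / mass p V))) =
      ∑ i ∈ V, v i * Real.log (cond p V i) := by
    rw [Finset.sum_add_distrib]
    have : ∑ i ∈ V, p i * ((v i * mass p V - p i * mass v V) / mass p V ^ 2 / (p i / mass p V)) =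
        ∑ i ∈ V, (v i - p i * (mass v V / mass p V)) := by
      refine Finset.sum_congr rfl fun i hiV => ?_
      have := (hp i hiV).ne'
      field_simp
    rw [this, Finset.sum_sub_distrib, ← Finset.sum_mul]
    change _ + (mass v V - mass p V * _) = _
    rw [mul_div_cancel₀ _ hP.ne']
    simp [cond]
  have hent := sum_mul_log_div_mass hp
  rw [hz, hent]
  unfold cliqueEntropyDeriv
  have h2 : mass p V = √(mass p V) ^ 2 := (Real.sq_sqrt hP.le).symm
  generalize √(mass p V) = s at *
  rw [h2]
  field_simp
  ring

/-- The Bregman divergence of `cliqueEntropy` in terms of the square roots of the clique masses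
and the conditional distributions. -/
theorem bregman_cliqueEntropy (α : ℝ) (hV : V.Nonempty) (hp : ∀ i ∈ V, 0 < p i)
    (hp' : ∀ i ∈ V, 0 < p' i) :
    cliqueEntropy α V p' - cliqueEntropy α V p - cliqueEntropyDeriv α V p (p' - p) =
      1 / √(mass p V) * ((α + entropy V (cond p V)) * (√(mass p' V) - √(mass p V)) ^ 2 / 2 +
        mass p' V * relEntropy V (cond p' V) (cond p V) +
        √(mass p' V) * (√(mass p' V) - √(mass p V)) *
          (entropy V (cond p' V) - entropy V (cond p V))) := by
  have hP := mass_pos hV hp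
  have hP' := mass_pos hV hp'
  have hs := Real.sqrt_pos.2 hP
  have hs' := Real.sqrt_pos.2 hP'
  rw [cliqueEntropy_eq α hV hp, cliqueEntropy_eq α hV hp']
  have hm : mass (p' - p) V = mass p' V - mass p V := by
    simp [mass, Finset.sum_sub_distrib]
  have hrel : relEntropy V (cond p' V) (cond p V) =
      -entropy V (cond p' V) - ∑ i ∈ V, cond p' V i * Real.log (cond p V i) := by
    unfold relEntropy entropy
    rw [neg_neg, ← Finset.sum_sub_distrib]
    refine Finset.sum_congr rfl fun i hi => ?_
    rw [Real.log_div (cond_pos hp' i hi).ne' (cond_pos hp i hi).ne']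
    ring
  have hsum : ∑ i ∈ V, (p' - p) i * Real.log (cond p V i) =
      mass p' V * ∑ i ∈ V, cond p' V i * Real.log (cond p V i) +
        mass p V * entropy V (cond p V) := by
    unfold entropy
    rw [mul_neg, ← sub_eq_add_neg, Finset.mul_sum, Finset.mul_sum, ← Finset.sum_sub_distrib]
    refine Finset.sum_congr rfl fun i hi => ?_
    rw [← mul_assoc, ← mul_assoc, mul_cond hp i hi, mul_cond hp' i hi, Pi.sub_apply, sub_mul]
  unfold cliqueEntropyDeriv
  rw [hm, hsum, hrel]
  have h2 : mass p V = √(mass p V) ^ 2 := (Real.sq_sqrt hP.le).symm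
  have h2' : mass p' V = √(mass p' V) ^ 2 := (Real.sq_sqrt hP'.le).symm
  generalize entropy V (cond p V) = H at *
  generalize entropy V (cond p' V) = H' at *
  generalize ∑ i ∈ V, cond p' V i * Real.log (cond p V i) = C at *
  generalize √(mass p V) = s at *
  generalize √(mass p' V) = s' at *
  rw [h2, h2']
  field_simp
  ring

/-- The choice `α = 2 (L² + 1)` makes the cross term of the Bregman divergence absorbable, since
entropies differ by at most `L √KL`. -/
theorem le_bregman_cliqueEntropy {L : ℝ} (hL0 : 0 ≤ L) (hV : V.Nonempty) (hp : ∀ i ∈ V, 0 < p i)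
    (hp' : ∀ i ∈ V, 0 < p' i) (hL : ∀ i ∈ V, -L ≤ Real.log (cond p V i))
    (hL' : ∀ i ∈ V, -L ≤ Real.log (cond p' V i)) :
    1 / (2 * √(mass p V)) * ((L ^ 2 + 2) * (√(mass p' V) - √(mass p V)) ^ 2 +
        mass p' V * relEntropy V (cond p' V) (cond p V)) ≤
      cliqueEntropy (2 * (L ^ 2 + 1)) V p' - cliqueEntropy (2 * (L ^ 2 + 1)) V p -
        cliqueEntropyDeriv (2 * (L ^ 2 + 1)) V p (p' - p) := by
  rw [bregman_cliqueEntropy _ hV hp hp']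
  have hP' := mass_pos hV hp'
  have hs := Real.sqrt_pos.2 (mass_pos hV hp)
  have hs' := Real.sqrt_pos.2 hP'
  have hH := entropy_nonneg (cond_pos hp) (cond_le_one hp)
  have hK := relEntropy_nonneg (cond_pos hp) (cond_pos hp') (sum_cond hV hp) (sum_cond hV hp')
  have hTV := sum_abs_sub_le_sqrt_relEntropy (cond_pos hp) (cond_pos hp') (sum_cond hV hp)
    (sum_cond hV hp')
  have e1 := entropy_sub_le (cond_pos hp) (cond_pos hp') hL (cond_le_one hp) (sum_cond hV hp)
    (sum_cond hV hp')
  have e2 := entropy_sub_le (cond_pos hp') (cond_pos hp) hL' (cond_le_one hp') (sum_cond hV hp')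
    (sum_cond hV hp)
  have hsymm : ∑ i ∈ V, |cond p' V i - cond p V i| = ∑ i ∈ V, |cond p V i - cond p' V i| :=
    Finset.sum_congr rfl fun i _ => abs_sub_comm _ _
  rw [hsymm] at e2
  have hTV2 : L / 2 * ∑ i ∈ V, |cond p V i - cond p' V i| ≤
      L * √(relEntropy V (cond p' V) (cond p V)) := by
    have := mul_le_mul_of_nonneg_left hTV (by positivity : 0 ≤ L / 2)
    linarith
  have habs : |entropy V (cond p' V) - entropy V (cond p V)| ≤
      L * √(relEntropy V (cond p' V) (cond p V)) := abs_le.2 ⟨by linarith, by linarith⟩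
  have hK2 := Real.sq_sqrt hK
  have h2' := (Real.sq_sqrt hP'.le).symm
  generalize relEntropy V (cond p' V) (cond p V) = KL at *
  generalize entropy V (cond p V) = H at *
  generalize entropy V (cond p' V) = H' at *
  generalize √(mass p V) = s at *
  generalize √(mass p' V) = s' at *
  rw [h2', ← hK2]
  generalize √KL = y at *
  have hc : -(s' * (s' - s) * (H' - H)) ≤ s' * |s' - s| * (L * y) := by
    refine (neg_le_abs _).trans ?_
    rw [abs_mul, abs_mul, abs_of_pos hs']
    exact mul_le_mul_of_nonneg_left habs (by positivity)
  have hd : (s' - s) ^ 2 = |s' - s| ^ 2 := (sq_abs _).symm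
  rw [hd]
  generalize hdd : |s' - s| = d at *
  have : 1 / (2 * s) * ((L ^ 2 + 2) * d ^ 2 + s' ^ 2 * y ^ 2) =
      1 / s * (((L ^ 2 + 2) * d ^ 2 + s' ^ 2 * y ^ 2) / 2) := by field_simp
  rw [this]
  refine mul_le_mul_of_nonneg_left ?_ (by positivity)
  nlinarith [sq_nonneg (L * d - s' * y), mul_nonneg hH (sq_nonneg d)]

end Clique

/-! ### First-order optimality of the FTRL point -/

section Objective

variable {N K T : ℕ} {c : Fin N → Fin K}

theorem tsallisShannon_eq_sum (α : ℝ) (c : Fin N → Fin K) (p : Fin N → ℝ) :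
    tsallisShannon α c p = ∑ k, cliqueEntropy α (cell c k) p := by
  unfold tsallisShannon cliqueEntropy
  rw [Finset.sum_add_distrib, ← Finset.mul_sum]

theorem stepSize_inv (t : ℕ) : (stepSize t)⁻¹ = √(t : ℝ) := by
  unfold stepSize
  rw [one_div, inv_inv]

theorem gammaParam_pos (hNT : 3 ^ 11 ≤ N * T) : 0 < gammaParam N T := by
  have h0 : 0 < N * T := by omega
  have : (0 : ℝ) < (N : ℝ) * T := by exact_mod_cast h0
  unfold gammaParam
  positivity

theorem pos_of_mem_truncatedSimplex (hNT : 3 ^ 11 ≤ N * T) {p : Fin N → ℝ}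
    (hp : p ∈ truncatedSimplex N (gammaParam N T)) (i : Fin N) : 0 < p i :=
  (gammaParam_pos hNT).trans_le (hp.2.2 i)

theorem mass_cell_pos {G : SimpleGraph (Fin N)} (hc : IsCliqueCovering G c)
    (hNT : 3 ^ 11 ≤ N * T) {p : Fin N → ℝ} (hp : p ∈ truncatedSimplex N (gammaParam N T))
    (k : Fin K) : 0 < mass p (cell c k) :=
  mass_pos (hc.nonempty k) fun i _ => pos_of_mem_truncatedSimplex hNT hp i

theorem sum_mass_cell (c : Fin N → Fin K) (p : Fin N → ℝ) :
    ∑ k, mass p (cell c k) = ∑ i, p i := by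
  unfold mass cell
  exact Finset.sum_fiberwise _ _ _

theorem sum_cell (c : Fin N → Fin K) (f : Fin N → ℝ) :
    ∑ k, ∑ i ∈ cell c k, f i = ∑ i, f i := sum_mass_cell c f

theorem mass_le_one {γ : ℝ} {p : Fin N → ℝ} (hp : p ∈ truncatedSimplex N γ)
    (A : Finset (Fin N)) : mass p A ≤ 1 := by
  rw [← hp.2.1]
  exact Finset.sum_le_sum_of_subset_of_nonneg (Finset.subset_univ _) fun i _ _ => hp.1 i

theorem mass_cell_le_one {γ : ℝ} {p : Fin N → ℝ} (hp : p ∈ truncatedSimplex N γ) (k : Fin K) :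
    mass p (cell c k) ≤ 1 := mass_le_one hp _

/-- The truncation level `γ = 1 / (N T)` bounds the logarithms of conditional probabilities. -/
theorem neg_log_le_log_cond {G : SimpleGraph (Fin N)} (hc : IsCliqueCovering G c)
    (hNT : 3 ^ 11 ≤ N * T) {p : Fin N → ℝ} (hp : p ∈ truncatedSimplex N (gammaParam N T))
    (k : Fin K) (i : Fin N) :
    -Real.log ((N : ℝ) * T) ≤ Real.log (cond p (cell c k) i) := by
  have hγ := gammaParam_pos hNT
  have h1 : gammaParam N T ≤ cond p (cell c k) i := by
    unfold cond
    rw [le_div_iff₀ (mass_cell_pos hc hNT hp k)]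
    have := mass_cell_le_one (c := c) hp k
    nlinarith [hp.2.2 i]
  have h2 : -Real.log ((N : ℝ) * T) = Real.log (gammaParam N T) := by
    unfold gammaParam
    rw [one_div, Real.log_inv]
  rw [h2]
  exact Real.log_le_log hγ h1

theorem twelve_le_log (hNT : 3 ^ 11 ≤ N * T) : 12 ≤ Real.log ((N : ℝ) * T) := by
  have h : ((3 : ℝ) ^ 11) ≤ (N : ℝ) * T := by exact_mod_cast hNT
  rw [Real.le_log_iff_exp_le (by linarith [pow_pos (three_pos (α := ℝ)) 11])]
  refine le_trans ?_ h
  have h1 : Real.exp 12 = Real.exp 1 ^ 12 := by rw [← Real.exp_nat_mul]; norm_num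
  rw [h1]
  calc Real.exp 1 ^ 12 ≤ 2.7182818286 ^ 12 := by
        gcongr
        exact Real.exp_one_lt_d9.le
    _ ≤ 3 ^ 11 := by norm_num

/-- The part of the divergence of `R_t`, with `τ = √t` and `L = log (N T)`, that a single clique
`V` contributes: squared change of `√p(V)`, relative entropy inside `V`, and the log-barrier. -/
noncomputable def cliqueDiv (L τ : ℝ) (V : Finset (Fin N)) (p' p : Fin N → ℝ) : ℝ :=
  τ / (2 * √(mass p V)) * ((L ^ 2 + 2) * (√(mass p' V) - √(mass p V)) ^ 2 +
    mass p' V * relEntropy V (cond p' V) (cond p V)) +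
  9 * (mass p' V / mass p V - 1 - Real.log (mass p' V / mass p V))

/-- If a function on `[0, 1]` is minimal at `0`, its derivative there is nonnegative. -/
theorem deriv_nonneg_of_forall_le {f : ℝ → ℝ} {f' : ℝ} (hf : HasDerivAt f f' 0)
    (h : ∀ ε ∈ Set.Icc (0 : ℝ) 1, f 0 ≤ f ε) : 0 ≤ f' := by
  have ht := (hasDerivAt_iff_tendsto_slope.1 hf).mono_left
    (nhdsWithin_mono (0 : ℝ) (fun x (hx : x ∈ Set.Ioi (0 : ℝ)) => ne_of_gt hx))
  refine ge_of_tendsto ht ?_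
  have : Set.Ioc (0 : ℝ) 1 ∈ nhdsWithin (0 : ℝ) (Set.Ioi 0) := Ioc_mem_nhdsGT zero_lt_one
  filter_upwards [this] with x hx
  rw [slope_def_field, sub_zero]
  exact div_nonneg (sub_nonneg.2 (h x ⟨hx.1.le, hx.2⟩)) hx.1.le

/-- Around a minimizer over the truncated simplex the objective grows by at least the Bregman
divergence of the regularizer. -/
theorem sum_cliqueDiv_le_objective_sub {G : SimpleGraph (Fin N)} (hc : IsCliqueCovering G c)
    (hNT : 3 ^ 11 ≤ N * T) (t : ℕ) (Λ : Fin N → ℝ) {p p' : Fin N → ℝ}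
    (hp : p ∈ truncatedSimplex N (gammaParam N T)) (hp' : p' ∈ truncatedSimplex N (gammaParam N T))
    (hmin : IsMinOn (objective T c t Λ) (truncatedSimplex N (gammaParam N T)) p) :
    ∑ k, cliqueDiv (Real.log ((N : ℝ) * T)) √(t : ℝ) (cell c k) p' p ≤
      objective T c t Λ p' - objective T c t Λ p := by
  set L := Real.log ((N : ℝ) * T) with hLdef
  have hL0 : 0 ≤ L := by linarith [twelve_le_log hNT]
  have hpos := pos_of_mem_truncatedSimplex hNT hp
  have hpos' := pos_of_mem_truncatedSimplex hNT hp'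
  have hM := mass_cell_pos hc hNT hp
  have hM' := mass_cell_pos hc hNT hp'
  have hα : alphaParam N T = 2 * (L ^ 2 + 1) := rfl
  have h0 : p + (0 : ℝ) • (p' - p) = p := by simp
  have hobj : ∀ x, objective T c t Λ x = ∑ i, Λ i * x i +
      (√(t : ℝ) * ∑ k, cliqueEntropy (2 * (L ^ 2 + 1)) (cell c k) x +
        -9 * ∑ k, Real.log (mass x (cell c k))) := fun x => by
    unfold objective regularizer logBarrier
    rw [stepSize_inv, tsallisShannon_eq_sum, hα]
  have hderiv : HasDerivAt (fun ε : ℝ => objective T c t Λ (p + ε • (p' - p)))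
      (∑ i, Λ i * (p' - p) i + (√(t : ℝ) * ∑ k,
        cliqueEntropyDeriv (2 * (L ^ 2 + 1)) (cell c k) p (p' - p) +
        -9 * ∑ k, mass (p' - p) (cell c k) / mass p (cell c k))) 0 := by
    simp only [hobj]
    refine HasDerivAt.add ?_ (HasDerivAt.add ?_ ?_)
    · refine HasDerivAt.fun_sum fun i _ => ?_
      simpa using (((hasDerivAt_id (0 : ℝ)).mul_const ((p' - p) i)).const_add (p i)).const_mul (Λ i)
    · refine HasDerivAt.const_mul _ (HasDerivAt.fun_sum fun k _ => ?_)
      exact hasDerivAt_cliqueEntropy _ (hc.nonempty k) (fun i _ => hpos i) _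
    · refine HasDerivAt.const_mul _ (HasDerivAt.fun_sum fun k _ => ?_)
      have := (hasDerivAt_mass p (p' - p) (cell c k)).log (by simpa [h0] using (hM k).ne')
      simpa only [h0] using this
  have hnonneg := deriv_nonneg_of_forall_le hderiv (fun ε hε => by
    rw [h0]
    refine hmin ⟨fun i => ?_, ?_, fun i => ?_⟩
    · simp only [Pi.add_apply, Pi.smul_apply, Pi.sub_apply, smul_eq_mul]
      nlinarith [hp.1 i, hp'.1 i, hε.1, hε.2]
    · simp only [Pi.add_apply, Pi.smul_apply, Pi.sub_apply, smul_eq_mul]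
      rw [Finset.sum_add_distrib, ← Finset.mul_sum, Finset.sum_sub_distrib, hp.2.1, hp'.2.1]
      ring
    · simp only [Pi.add_apply, Pi.smul_apply, Pi.sub_apply, smul_eq_mul]
      nlinarith [hp.2.2 i, hp'.2.2 i, hε.1, hε.2])
  have hk : ∀ k, cliqueDiv L √(t : ℝ) (cell c k) p' p ≤
      √(t : ℝ) * (cliqueEntropy (2 * (L ^ 2 + 1)) (cell c k) p' -
        cliqueEntropy (2 * (L ^ 2 + 1)) (cell c k) p -
        cliqueEntropyDeriv (2 * (L ^ 2 + 1)) (cell c k) p (p' - p)) +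
      9 * (mass (p' - p) (cell c k) / mass p (cell c k) - (Real.log (mass p' (cell c k)) -
        Real.log (mass p (cell c k)))) := by
    intro k
    have h1 := le_bregman_cliqueEntropy hL0 (hc.nonempty k) (fun i _ => hpos i)
      (fun i _ => hpos' i) (fun i _ => neg_log_le_log_cond hc hNT hp k i)
      (fun i _ => neg_log_le_log_cond hc hNT hp' k i)
    have h2 := mul_le_mul_of_nonneg_left h1 (Real.sqrt_nonneg (t : ℝ))
    have h3 : mass (p' - p) (cell c k) / mass p (cell c k) =
        mass p' (cell c k) / mass p (cell c k) - 1 := by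
      have : mass (p' - p) (cell c k) = mass p' (cell c k) - mass p (cell c k) := by
        simp [mass, Finset.sum_sub_distrib]
      rw [this, sub_div, div_self (hM k).ne']
    unfold cliqueDiv
    rw [h3, Real.log_div (hM' k).ne' (hM k).ne']
    have h4 : ∀ X : ℝ, √(t : ℝ) / (2 * √(mass p (cell c k))) * X =
        √(t : ℝ) * (1 / (2 * √(mass p (cell c k))) * X) := fun X => by ring
    rw [h4]
    linarith
  have hsum := Finset.sum_le_sum fun k (_ : k ∈ Finset.univ) => hk k
  rw [Finset.sum_add_distrib, ← Finset.mul_sum, ← Finset.mul_sum, Finset.sum_sub_distrib,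
    Finset.sum_sub_distrib, Finset.sum_sub_distrib, Finset.sum_sub_distrib] at hsum
  refine hsum.trans ?_
  rw [hobj p', hobj p]
  have hlin : ∑ i, Λ i * (p' - p) i = ∑ i, Λ i * p' i - ∑ i, Λ i * p i := by
    rw [← Finset.sum_sub_distrib]
    exact Finset.sum_congr rfl fun i _ => by rw [Pi.sub_apply, mul_sub]
  rw [hlin] at hnonneg
  linarith

end Objective

/-! ### Stability of a single clique -/

section Stability

variable {N : ℕ} {V : Finset (Fin N)} {p p' : Fin N → ℝ} {L τ : ℝ}

theorem barrier_nonneg {r : ℝ} (hr : 0 < r) : 0 ≤ 9 * (r - 1 - Real.log r) := by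
  linarith [Real.log_le_sub_one_of_pos hr]

/-- Splitting a linear functional into the change of the clique mass and the change of the
conditional distribution. -/
theorem sum_mul_sub_eq (hp : ∀ i ∈ V, 0 < p i) (hp' : ∀ i ∈ V, 0 < p' i)
    (z : Fin N → ℝ) :
    ∑ i ∈ V, z i * (p i - p' i) =
      (mass p V - mass p' V) * ∑ i ∈ V, z i * cond p V i +
        mass p' V * ∑ i ∈ V, z i * (cond p V i - cond p' V i) := by
  rw [Finset.mul_sum, Finset.mul_sum, ← Finset.sum_add_distrib]
  refine Finset.sum_congr rfl fun i hi => ?_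
  rw [← mul_cond hp i hi, ← mul_cond hp' i hi]
  ring

/-- A lower bound for `cliqueDiv` that uses only `L ^ 2 + 2 ≥ 100`. -/
theorem le_cliqueDiv (hL : 12 ≤ L) (hτ : 0 ≤ τ) (hV : V.Nonempty) (hp : ∀ i ∈ V, 0 < p i) :
    50 * τ / √(mass p V) * (√(mass p' V) - √(mass p V)) ^ 2 +
      τ / (2 * √(mass p V)) * (mass p' V * relEntropy V (cond p' V) (cond p V)) +
      9 * (mass p' V / mass p V - 1 - Real.log (mass p' V / mass p V)) ≤
      cliqueDiv L τ V p' p := by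
  have hs := Real.sqrt_pos.2 (mass_pos hV hp)
  unfold cliqueDiv
  have h : 50 * τ / √(mass p V) * (√(mass p' V) - √(mass p V)) ^ 2 =
      τ / (2 * √(mass p V)) * (100 * (√(mass p' V) - √(mass p V)) ^ 2) := by
    field_simp; ring
  rw [h, ← mul_add]
  have : τ / (2 * √(mass p V)) * (100 * (√(mass p' V) - √(mass p V)) ^ 2 +
        mass p' V * relEntropy V (cond p' V) (cond p V)) ≤
      τ / (2 * √(mass p V)) * ((L ^ 2 + 2) * (√(mass p' V) - √(mass p V)) ^ 2 +
        mass p' V * relEntropy V (cond p' V) (cond p V)) := by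
    gcongr
    nlinarith
  linarith

theorem cliqueDiv_nonneg (hL : 12 ≤ L) (hτ : 0 ≤ τ) (hV : V.Nonempty) (hp : ∀ i ∈ V, 0 < p i)
    (hp' : ∀ i ∈ V, 0 < p' i) : 0 ≤ cliqueDiv L τ V p' p := by
  refine le_trans ?_ (le_cliqueDiv hL hτ hV hp)
  have h1 := relEntropy_nonneg (cond_pos hp) (cond_pos hp') (sum_cond hV hp) (sum_cond hV hp')
  have h2 := mass_pos hV hp
  have h3 := mass_pos hV hp'
  have := barrier_nonneg (div_pos h3 h2)
  positivity

/-- Stability of the drawn clique under its nonnegative importance-weighted losses. When `p'(V)`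
is at least twice `p(V)` the log-barrier alone pays for the loss, which is at most `1`. -/
theorem stability_of_nonneg_loss (hL : 12 ≤ L) (hτ : 0 < τ) (hV : V.Nonempty)
    (hp : ∀ i ∈ V, 0 < p i) (hp' : ∀ i ∈ V, 0 < p' i) {z : Fin N → ℝ} (hz0 : ∀ i ∈ V, 0 ≤ z i)
    (hz1 : ∀ i ∈ V, z i ≤ 1 / mass p V) :
    ∑ i ∈ V, z i * (p i - p' i) ≤ cliqueDiv L τ V p' p + 2 / (τ * √(mass p V)) := by
  have hP := mass_pos hV hp
  have hP' := mass_pos hV hp'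
  have hs := Real.sqrt_pos.2 hP
  have hs' := Real.sqrt_pos.2 hP'
  have hK := relEntropy_nonneg (cond_pos hp) (cond_pos hp') (sum_cond hV hp) (sum_cond hV hp')
  have hdiv := le_cliqueDiv (p' := p') hL hτ.le hV hp
  by_cases hr : 2 * mass p V ≤ mass p' V
  · have h1 : ∑ i ∈ V, z i * (p i - p' i) ≤ 1 := by
      calc ∑ i ∈ V, z i * (p i - p' i) ≤ ∑ i ∈ V, 1 / mass p V * p i := by
            refine Finset.sum_le_sum fun i hi => ?_
            have := mul_le_mul_of_nonneg_right (hz1 i hi) (hp i hi).le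
            nlinarith [mul_nonneg (hz0 i hi) (hp' i hi).le]
        _ = 1 := by
            rw [← Finset.mul_sum]
            exact one_div_mul_cancel hP.ne'
    have hr2 : 2 ≤ mass p' V / mass p V := (le_div_iff₀ hP).2 hr
    set r := mass p' V / mass p V with hrdef
    have hlog : Real.log r ≤ r / 2 - 1 + Real.log 2 := by
      have h2 := Real.log_le_sub_one_of_pos (x := r / 2) (by linarith)
      rw [Real.log_div (by linarith) (by norm_num)] at h2
      linarith
    have hlog2 := Real.log_two_lt_d9
    have h5 : 0 ≤ 50 * τ / √(mass p V) * (√(mass p' V) - √(mass p V)) ^ 2 := by positivity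
    have h6 : 0 ≤ τ / (2 * √(mass p V)) *
      (mass p' V * relEntropy V (cond p' V) (cond p V)) := by positivity
    have h7 : 0 ≤ 2 / (τ * √(mass p V)) := by positivity
    linarith
  · push Not at hr
    rw [sum_mul_sub_eq hp hp']
    have hb := barrier_nonneg (div_pos hP' hP)
    -- the change of the clique mass
    have hA : (mass p V - mass p' V) * ∑ i ∈ V, z i * cond p V i ≤
        50 * τ / √(mass p V) * (√(mass p' V) - √(mass p V)) ^ 2 + 1 / (τ * √(mass p V)) := by
      have ha0 : 0 ≤ ∑ i ∈ V, z i * cond p V i :=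
        Finset.sum_nonneg fun i hi => mul_nonneg (hz0 i hi) (cond_pos hp i hi).le
      have ha1 : ∑ i ∈ V, z i * cond p V i ≤ 1 / mass p V := by
        calc ∑ i ∈ V, z i * cond p V i ≤ ∑ i ∈ V, 1 / mass p V * cond p V i :=
              Finset.sum_le_sum fun i hi =>
                mul_le_mul_of_nonneg_right (hz1 i hi) (cond_pos hp i hi).le
          _ = 1 / mass p V := by rw [← Finset.mul_sum, sum_cond hV hp, mul_one]
      by_cases hle : mass p V ≤ mass p' V
      · refine le_trans (mul_nonpos_of_nonpos_of_nonneg (by linarith) ha0) ?_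
        positivity
      · push Not at hle
        refine (mul_le_mul_of_nonneg_left ha1 (by linarith)).trans ?_
        have hs's : √(mass p' V) ≤ √(mass p V) := Real.sqrt_le_sqrt hle.le
        have h2 : mass p V = √(mass p V) ^ 2 := (Real.sq_sqrt hP.le).symm
        have h2' : mass p' V = √(mass p' V) ^ 2 := (Real.sq_sqrt hP'.le).symm
        generalize √(mass p V) = s at *
        generalize √(mass p' V) = s' at *
        rw [h2, h2']
        have e : 50 * τ / s * (s' - s) ^ 2 + 1 / (τ * s) - (s ^ 2 - s' ^ 2) * (1 / s ^ 2) =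
            (50 * τ ^ 2 * (s' - s) ^ 2 * s + s - τ * (s ^ 2 - s' ^ 2)) / (τ * s ^ 2) := by
          field_simp
        have : 0 ≤ 50 * τ ^ 2 * (s' - s) ^ 2 * s + s - τ * (s ^ 2 - s' ^ 2) := by
          have e1 : s ^ 2 - s' ^ 2 ≤ (s - s') * (2 * s) := by nlinarith
          have e2 := mul_le_mul_of_nonneg_left e1 hτ.le
          nlinarith [mul_nonneg hs.le (sq_nonneg (τ * (s - s') - 1)),
            mul_nonneg hs.le (sq_nonneg (τ * (s - s')))]
        have := div_nonneg this (by positivity : 0 ≤ τ * s ^ 2)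
        linarith
    -- the change of the conditional distribution
    have hB : mass p' V * ∑ i ∈ V, z i * (cond p V i - cond p' V i) ≤
        τ / (2 * √(mass p V)) * (mass p' V * relEntropy V (cond p' V) (cond p V)) +
          1 / (τ * √(mass p V)) := by
      have hc1 : ∑ i ∈ V, z i * (cond p V i - cond p' V i) ≤
          1 / mass p V * √(relEntropy V (cond p' V) (cond p V)) := by
        -- centring the loss at `1 / (2 p(V))` gains a factor `2`
        have hcen : ∑ i ∈ V, z i * (cond p V i - cond p' V i) =
            ∑ i ∈ V, (z i - 1 / (2 * mass p V)) * (cond p V i - cond p' V i) := by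
          simp only [sub_mul (z _)]
          rw [Finset.sum_sub_distrib, ← Finset.mul_sum, Finset.sum_sub_distrib, sum_cond hV hp,
            sum_cond hV hp', sub_self, mul_zero, sub_zero]
        have hhalf : 1 / mass p V = 2 * (1 / (2 * mass p V)) := by field_simp
        rw [hcen]
        calc ∑ i ∈ V, (z i - 1 / (2 * mass p V)) * (cond p V i - cond p' V i)
            ≤ ∑ i ∈ V, 1 / (2 * mass p V) * |cond p V i - cond p' V i| := by
              refine Finset.sum_le_sum fun i hi => ?_
              refine (le_abs_self _).trans ?_
              rw [abs_mul]
              refine mul_le_mul_of_nonneg_right (abs_le.2 ⟨?_, ?_⟩) (abs_nonneg _)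
              · linarith [hz0 i hi]
              · linarith [hz1 i hi]
          _ ≤ 1 / (2 * mass p V) * (2 * √(relEntropy V (cond p' V) (cond p V))) := by
              rw [← Finset.mul_sum]
              exact mul_le_mul_of_nonneg_left (sum_abs_sub_le_sqrt_relEntropy (cond_pos hp)
                (cond_pos hp') (sum_cond hV hp) (sum_cond hV hp')) (by positivity)
          _ = 1 / mass p V * √(relEntropy V (cond p' V) (cond p V)) := by field_simp
      refine (mul_le_mul_of_nonneg_left hc1 hP'.le).trans ?_
      have hK2 := Real.sq_sqrt hK
      generalize relEntropy V (cond p' V) (cond p V) = KL at *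
      generalize √KL = y at hK2 ⊢
      subst hK2
      have h2 : mass p V = √(mass p V) ^ 2 := (Real.sq_sqrt hP.le).symm
      generalize √(mass p V) = s at *
      generalize mass p' V = m' at *
      rw [h2] at hr ⊢
      have e : τ / (2 * s) * (m' * y ^ 2) + 1 / (τ * s) - m' * (1 / s ^ 2 * y) =
          (m' * (s * τ * y - 1) ^ 2 + (2 * s ^ 2 - m')) / (2 * τ * s ^ 3) := by
        field_simp; ring
      have : 0 ≤ (m' * (s * τ * y - 1) ^ 2 + (2 * s ^ 2 - m')) / (2 * τ * s ^ 3) := by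
        have : 0 ≤ 2 * s ^ 2 - m' := by linarith
        positivity
      linarith
    have hsum : 2 / (τ * √(mass p V)) = 1 / (τ * √(mass p V)) + 1 / (τ * √(mass p V)) := by ring
    linarith

/-- Stability of a clique whose arms all suffer the same nonpositive loss `-ζ`. -/
theorem stability_of_const_loss (hL : 12 ≤ L) (hτ : 1 ≤ τ) (hV : V.Nonempty)
    (hp : ∀ i ∈ V, 0 < p i) (hp' : ∀ i ∈ V, 0 < p' i) (hP1 : mass p V ≤ 1) {ζ : ℝ} (hζ0 : 0 ≤ ζ)
    (hζ : ζ ≤ 2) :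
    ζ * (mass p' V - mass p V) ≤ cliqueDiv L τ V p' p + √(mass p V) / τ := by
  have hP := mass_pos hV hp
  have hP' := mass_pos hV hp'
  have hs := Real.sqrt_pos.2 hP
  have hs' := Real.sqrt_pos.2 hP'
  have hK := relEntropy_nonneg (cond_pos hp) (cond_pos hp') (sum_cond hV hp) (sum_cond hV hp')
  have hdiv := le_cliqueDiv (p' := p') hL (by linarith : 0 ≤ τ) hV hp
  have hb := barrier_nonneg (div_pos hP' hP)
  have h6 : 0 ≤ τ / (2 * √(mass p V)) *
    (mass p' V * relEntropy V (cond p' V) (cond p V)) := by positivity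
  suffices h : ζ * (mass p' V - mass p V) ≤
      50 * τ / √(mass p V) * (√(mass p' V) - √(mass p V)) ^ 2 + √(mass p V) / τ by linarith
  by_cases hle : mass p' V ≤ mass p V
  · refine (mul_nonpos_of_nonneg_of_nonpos hζ0 (by linarith)).trans (by positivity)
  · push Not at hle
    refine (mul_le_mul_of_nonneg_right hζ (by linarith)).trans ?_
    have hs's : √(mass p V) ≤ √(mass p' V) := Real.sqrt_le_sqrt hle.le
    have hs1 : √(mass p V) ≤ 1 := Real.sqrt_le_one.2 hP1
    have h2 : mass p V = √(mass p V) ^ 2 := (Real.sq_sqrt hP.le).symm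
    have h2' : mass p' V = √(mass p' V) ^ 2 := (Real.sq_sqrt hP'.le).symm
    generalize √(mass p V) = s at *
    generalize √(mass p' V) = s' at *
    rw [h2, h2']
    obtain ⟨d, hd⟩ : ∃ d, d = s' - s := ⟨_, rfl⟩
    have hd0 : 0 ≤ d := by linarith
    have hs'd : s' = s + d := by linarith
    subst hs'd
    have e : 50 * τ / s * (s + d - s) ^ 2 + s / τ - 2 * ((s + d) ^ 2 - s ^ 2) =
        (50 * τ ^ 2 * d ^ 2 + s ^ 2 - 4 * (τ * d) * s ^ 2 - 2 * (τ * d) * d * s) / (s * τ) := by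
      field_simp; ring
    have : 0 ≤ 50 * τ ^ 2 * d ^ 2 + s ^ 2 - 4 * (τ * d) * s ^ 2 - 2 * (τ * d) * d * s := by
      have hds : d * s ≤ τ * d := by nlinarith
      have e1 : 4 * (τ * d) * s ^ 2 ≤ 4 * (τ * d) * s := by
        have : s ^ 2 ≤ s := by nlinarith
        exact mul_le_mul_of_nonneg_left this (by positivity)
      have e2 : (τ * d) * (d * s) ≤ (τ * d) * (τ * d) :=
        mul_le_mul_of_nonneg_left hds (by positivity)
      nlinarith [sq_nonneg (2 * (τ * d) - s), sq_nonneg (τ * d)]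
    have := div_nonneg this (by positivity : 0 ≤ s * τ)
    linarith

theorem exp_le_one_add_add_two_mul_sq {u : ℝ} (hu : |u| ≤ 20 / 9) :
    Real.exp u ≤ 1 + u + 2 * u ^ 2 := by
  have hv : |u / 3| ≤ 20 / 27 := by
    rw [abs_div, abs_of_pos (three_pos (α := ℝ))]
    linarith
  have h1 := Real.abs_exp_sub_one_sub_id_le (x := u / 3) (by linarith)
  have h2 : Real.exp (u / 3) ≤ 1 + u / 3 + (u / 3) ^ 2 := by
    linarith [le_abs_self (Real.exp (u / 3) - 1 - u / 3)]
  have h3 : Real.exp u = Real.exp (u / 3) ^ 3 := by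
    rw [← Real.exp_nat_mul]; congr 1; push_cast; ring
  rw [h3]
  refine (pow_le_pow_left₀ (Real.exp_pos _).le h2 3).trans ?_
  obtain ⟨v, hvd⟩ : ∃ v, v = u / 3 := ⟨_, rfl⟩
  have hu' : u = 3 * v := by linarith
  rw [← hvd] at hv ⊢
  rw [hu']
  obtain ⟨ha, hb⟩ := abs_le.1 hv
  have h4 : 0 ≤ 12 - 7 * v - 6 * v ^ 2 - 3 * v ^ 3 - v ^ 4 := by
    have e2 : v ^ 2 ≤ (20 / 27) ^ 2 := by nlinarith
    have e4 : v ^ 4 ≤ (20 / 27) ^ 4 := by nlinarith [sq_nonneg v]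
    have e3 : v ^ 3 ≤ 20 / 27 * v ^ 2 := by nlinarith [sq_nonneg v]
    norm_num at e2 e4 e3
    linarith
  nlinarith [mul_nonneg (sq_nonneg v) h4]

/-- Gibbs' variational bound in one coordinate: the Fenchel inequality for `r log r - r + 1`
combined with a second-order bound for the exponential. -/
theorem mul_sub_le_of_abs_le {b x y z : ℝ} (hb : 0 < b) (hx : 0 < x) (hy : 0 < y)
    (hz : |z| ≤ 20 / 9 * b) :
    z * (x - y) - b * (y * Real.log (y / x) - y + x) ≤ 2 / b * (x * z ^ 2) := by
  have hu : |-(z / b)| ≤ 20 / 9 := by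
    rw [abs_neg, abs_div, abs_of_pos hb]
    exact (div_le_iff₀ hb).2 hz
  have h1 := exp_le_one_add_add_two_mul_sq hu
  have hw := Real.exp_pos (-(z / b))
  -- `log (w x / y) ≤ w x / y - 1` with `w = exp (-z / b)`
  have h2 := Real.log_le_sub_one_of_pos (x := Real.exp (-(z / b)) / (y / x)) (by positivity)
  rw [Real.log_div hw.ne' (by positivity), Real.log_exp] at h2
  have h3 : Real.exp (-(z / b)) / (y / x) * y = x * Real.exp (-(z / b)) := by
    field_simp
  have h4 := mul_le_mul_of_nonneg_right h2 hy.le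
  rw [sub_mul (Real.exp (-(z / b)) / (y / x)), h3] at h4
  have h5 := mul_le_mul_of_nonneg_left h1 hx.le
  obtain ⟨u, hud⟩ : ∃ u, u = z / b := ⟨_, rfl⟩
  have hz' : z = b * u := by rw [hud]; field_simp
  rw [← hud] at h4 h5
  have e : 2 / b * (x * z ^ 2) = b * (2 * x * u ^ 2) := by
    rw [hz']; field_simp
  rw [e, hz']
  have h6 : u * (x - y) - (y * Real.log (y / x) - y + x) ≤ 2 * x * u ^ 2 := by linarith
  have := mul_le_mul_of_nonneg_left h6 hb.le
  linarith

/-- Gibbs' variational bound: an approximate convex conjugate of the relative entropy. -/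
theorem sum_mul_sub_sub_relEntropy_le {b : ℝ} {q q' z : Fin N → ℝ} (hb : 0 < b)
    (hq : ∀ i ∈ V, 0 < q i) (hq' : ∀ i ∈ V, 0 < q' i) (h1 : ∑ i ∈ V, q i = 1)
    (h1' : ∑ i ∈ V, q' i = 1) (hz : ∀ i ∈ V, |z i| ≤ 20 / 9 * b) :
    ∑ i ∈ V, z i * (q i - q' i) - b * relEntropy V q' q ≤ 2 / b * ∑ i ∈ V, q i * z i ^ 2 := by
  have hsum := Finset.sum_le_sum fun i hi =>
    mul_sub_le_of_abs_le hb (hq i hi) (hq' i hi) (hz i hi)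
  rw [Finset.sum_sub_distrib, ← Finset.mul_sum, ← Finset.mul_sum, Finset.sum_add_distrib,
    Finset.sum_sub_distrib, h1, h1', sub_add_cancel] at hsum
  exact hsum

/-- Stability of the clique of the arm `j` once the losses are shifted to vanish at `j`: only the
mass of the other arms of the clique enters. -/
theorem stability_of_loss_vanishing_at (hL : 12 ≤ L) (hτ : 1 ≤ τ) {j : Fin N} (hj : j ∈ V)
    (hp : ∀ i ∈ V, 0 < p i) (hp' : ∀ i ∈ V, 0 < p' i) (hP1 : mass p V ≤ 1)
    (hP1' : mass p' V ≤ 1) (hP9 : 9 / 10 ≤ mass p V) {z : Fin N → ℝ} (hzj : z j = 0)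
    (hz : ∀ i ∈ V, |z i| ≤ 1 / mass p V) :
    ∑ i ∈ V, z i * (p i - p' i) ≤
      cliqueDiv L τ V p' p + 8 * √(mass p (V.erase j)) / τ := by
  have hV : V.Nonempty := ⟨j, hj⟩
  have hP := mass_pos hV hp
  have hP' := mass_pos hV hp'
  have hs := Real.sqrt_pos.2 hP
  have hs' := Real.sqrt_pos.2 hP'
  have hs1 : √(mass p V) ≤ 1 := Real.sqrt_le_one.2 hP1
  have hdiv := le_cliqueDiv (p' := p') hL (by linarith : 0 ≤ τ) hV hp
  have hb := barrier_nonneg (div_pos hP' hP)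
  have hinv : 1 / mass p V ≤ 10 / 9 := by
    rw [div_le_iff₀ hP]; linarith
  set x := ∑ i ∈ V.erase j, cond p V i with hx
  have hx0 : 0 ≤ x :=
    Finset.sum_nonneg fun i hi => (cond_pos hp i (Finset.mem_of_mem_erase hi)).le
  have hx1 : x ≤ 1 := by
    have := Finset.add_sum_erase V (cond p V) hj
    rw [sum_cond hV hp] at this
    linarith [cond_pos hp j hj]
  have hPx : mass p (V.erase j) = mass p V * x := by
    rw [hx, Finset.mul_sum]
    exact Finset.sum_congr rfl fun i hi => (mul_cond hp i (Finset.mem_of_mem_erase hi)).symm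
  have h6x : 6 * x ≤ 8 * √(mass p (V.erase j)) := by
    have : 3 / 4 * x ≤ √(mass p (V.erase j)) := by
      refine Real.le_sqrt_of_sq_le ?_
      rw [hPx]
      nlinarith
    linarith
  rw [sum_mul_sub_eq hp hp']
  have hA : (mass p V - mass p' V) * ∑ i ∈ V, z i * cond p V i ≤
      50 * τ / √(mass p V) * (√(mass p' V) - √(mass p V)) ^ 2 + x / τ := by
    have ha : |∑ i ∈ V, z i * cond p V i| ≤ 10 / 9 * x := by
      rw [← Finset.add_sum_erase V _ hj, hzj, zero_mul, zero_add]
      refine (Finset.abs_sum_le_sum_abs _ _).trans ?_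
      rw [hx, Finset.mul_sum]
      refine Finset.sum_le_sum fun i hi => ?_
      have hi' := Finset.mem_of_mem_erase hi
      rw [abs_mul, abs_of_pos (cond_pos hp i hi')]
      exact mul_le_mul_of_nonneg_right ((hz i hi').trans hinv) (cond_pos hp i hi').le
    have h2 : mass p V = √(mass p V) ^ 2 := (Real.sq_sqrt hP.le).symm
    have h2' : mass p' V = √(mass p' V) ^ 2 := (Real.sq_sqrt hP'.le).symm
    have hd : |mass p V - mass p' V| ≤ 2 * |√(mass p' V) - √(mass p V)| := by
      have : mass p V - mass p' V =
          -((√(mass p' V) - √(mass p V)) * (√(mass p' V) + √(mass p V))) := by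
        nlinarith
      rw [this, abs_neg, abs_mul, abs_of_nonneg (a := √(mass p' V) + √(mass p V)) (by positivity)]
      nlinarith [abs_nonneg (√(mass p' V) - √(mass p V))]
    have h50 : 50 * τ * (√(mass p' V) - √(mass p V)) ^ 2 ≤
        50 * τ / √(mass p V) * (√(mass p' V) - √(mass p V)) ^ 2 := by
      refine mul_le_mul_of_nonneg_right ?_ (sq_nonneg _)
      rw [le_div_iff₀ hs]
      nlinarith
    refine le_trans ?_ (add_le_add_left h50 _)
    refine (le_abs_self _).trans ?_
    rw [abs_mul, ← sq_abs (√(mass p' V) - √(mass p V))]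
    refine (mul_le_mul hd ha (abs_nonneg _) (by positivity)).trans ?_
    generalize |√(mass p' V) - √(mass p V)| = d
    have e : 50 * τ * d ^ 2 + x / τ - 2 * d * (10 / 9 * x) =
        (50 * (τ * d) ^ 2 + x - 20 / 9 * (τ * d) * x) / τ := by
      field_simp; ring
    have : 0 ≤ 50 * (τ * d) ^ 2 + x - 20 / 9 * (τ * d) * x := by
      nlinarith [sq_nonneg (2 * (τ * d) - x), sq_nonneg (τ * d)]
    have := div_nonneg this (by positivity : 0 ≤ τ)
    linarith
  have hB : mass p' V * ∑ i ∈ V, z i * (cond p V i - cond p' V i) ≤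
      τ / (2 * √(mass p V)) * (mass p' V * relEntropy V (cond p' V) (cond p V)) + 5 * x / τ := by
    obtain ⟨b, hbd⟩ : ∃ b, b = τ / (2 * √(mass p V)) := ⟨_, rfl⟩
    have hb2 : 1 / 2 * τ ≤ b := by
      rw [hbd, le_div_iff₀ (by positivity)]
      nlinarith
    have hb0 : 0 < b := by linarith
    rw [← hbd]
    have hsum := sum_mul_sub_sub_relEntropy_le hb0 (cond_pos hp) (cond_pos hp') (sum_cond hV hp)
      (sum_cond hV hp') (z := z) fun i hi => (hz i hi).trans (by linarith)
    have hsq : ∑ i ∈ V, cond p V i * z i ^ 2 ≤ 100 / 81 * x := by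
      rw [← Finset.add_sum_erase V _ hj, hzj, hx, Finset.mul_sum]
      simp only [ne_eq, OfNat.ofNat_ne_zero, not_false_eq_true, zero_pow, mul_zero, zero_add]
      refine Finset.sum_le_sum fun i hi => ?_
      have hi' := Finset.mem_of_mem_erase hi
      have hzi : z i ^ 2 ≤ 100 / 81 := by
        rw [← sq_abs]
        calc |z i| ^ 2 ≤ (10 / 9) ^ 2 :=
              pow_le_pow_left₀ (abs_nonneg _) ((hz i hi').trans hinv) 2
          _ = 100 / 81 := by norm_num
      rw [mul_comm]
      exact mul_le_mul_of_nonneg_right hzi (cond_pos hp i hi').le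
    have h2b : 2 / b ≤ 4 / τ := by
      rw [div_le_div_iff₀ hb0 (by linarith)]
      linarith
    have hfin : 2 / b * ∑ i ∈ V, cond p V i * z i ^ 2 ≤ 5 * x / τ := by
      calc 2 / b * ∑ i ∈ V, cond p V i * z i ^ 2 ≤ 4 / τ * (100 / 81 * x) :=
            mul_le_mul h2b hsq (Finset.sum_nonneg fun i hi =>
              mul_nonneg (cond_pos hp i hi).le (sq_nonneg _)) (by positivity)
        _ ≤ 5 * x / τ := by
            rw [div_mul_eq_mul_div]
            exact div_le_div_of_nonneg_right (by linarith) (by linarith)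
    have h7 : ∑ i ∈ V, z i * (cond p V i - cond p' V i) -
        b * relEntropy V (cond p' V) (cond p V) ≤ 5 * x / τ := hsum.trans hfin
    have h8 := mul_le_mul_of_nonneg_left h7 hP'.le
    have h9 : mass p' V * (5 * x / τ) ≤ 5 * x / τ :=
      mul_le_of_le_one_left (by positivity) hP1'
    linarith
  have h10 : x / τ + 5 * x / τ ≤ 8 * √(mass p (V.erase j)) / τ := by
    rw [← add_div]
    gcongr
    linarith
  linarith

end Stability

/-! ### Pathwise regret of the estimated losses -/

section Pathwise

variable {N K T : ℕ} {c : Fin N → Fin K}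

/-- `∑_{k ≠ k⋆} √(p(V_k))`, where `V_{k⋆}` is the clique of `iStar`. -/
noncomputable def offCliqueSum (c : Fin N → Fin K) (iStar : Fin N) (p : Fin N → ℝ) : ℝ :=
  ∑ k ∈ Finset.univ.erase (c iStar), √(mass p (cell c k))

/-- The bound on the stability term of a round with `τ = √t` in which the arm `j` is drawn from
`p`; its dependence on `j` is such that the mean over `j` is small. -/
noncomputable def stabilityBound (c : Fin N → Fin K) (iStar : Fin N) (τ : ℝ) (p : Fin N → ℝ)
    (j : Fin N) : ℝ :=
  1 / (τ * √(mass p (cell c (c j)))) *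
    if c j = c iStar then 20 * offCliqueSum c iStar p +
      8 * √(mass p ((cell c (c iStar)).erase iStar)) else 2

theorem offCliqueSum_nonneg (c : Fin N → Fin K) (iStar : Fin N) (p : Fin N → ℝ) :
    0 ≤ offCliqueSum c iStar p := Finset.sum_nonneg fun _ _ => Real.sqrt_nonneg _

theorem one_sub_mass_le_offCliqueSum {γ : ℝ} {p : Fin N → ℝ} (hp : p ∈ truncatedSimplex N γ)
    (iStar : Fin N) : 1 - mass p (cell c (c iStar)) ≤ offCliqueSum c iStar p := by
  have h := Finset.add_sum_erase Finset.univ (fun k => mass p (cell c k))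
    (Finset.mem_univ (c iStar))
  rw [sum_mass_cell, hp.2.1] at h
  have : ∑ k ∈ Finset.univ.erase (c iStar), mass p (cell c k) ≤ offCliqueSum c iStar p := by
    refine Finset.sum_le_sum fun k _ => ?_
    have h0 : 0 ≤ mass p (cell c k) := Finset.sum_nonneg fun i _ => hp.1 i
    refine Real.le_sqrt_of_sq_le ?_
    nlinarith [mass_cell_le_one (c := c) hp k]
  linarith

theorem mem_cell_self (c : Fin N → Fin K) (i : Fin N) : i ∈ cell c (c i) := by simp [cell]

theorem sum_lossEstimate_mul (c : Fin N → Fin K) (p l : Fin N → ℝ) (j : Fin N) (f : Fin N → ℝ) :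
    ∑ i, lossEstimate c p l j i * f i =
      ∑ i ∈ cell c (c j), l i / mass p (cell c (c j)) * f i := by
  rw [← Finset.sum_subset (Finset.subset_univ (cell c (c j)))]
  · refine Finset.sum_congr rfl fun i hi => ?_
    have hci : c i = c j := by simpa [cell] using hi
    rw [lossEstimate, if_pos hi, hci]
  · intro i _ hi
    rw [lossEstimate, if_neg hi, zero_mul]

/-- The stability term of one round. If the clique of `iStar` is drawn and carries most of the
mass, all losses are first shifted by the estimated loss of `iStar`, which does not change their
action on differences of probability vectors. -/
theorem stability_le {G : SimpleGraph (Fin N)} (hc : IsCliqueCovering G c)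
    (hNT : 3 ^ 11 ≤ N * T) {τ : ℝ} (hτ : 1 ≤ τ) {p p' : Fin N → ℝ}
    (hp : p ∈ truncatedSimplex N (gammaParam N T)) (hp' : p' ∈ truncatedSimplex N (gammaParam N T))
    {l : Fin N → ℝ} (hl : ∀ i, l i ∈ Set.Icc (0 : ℝ) 1) (iStar j : Fin N) :
    ∑ i, lossEstimate c p l j i * (p i - p' i) ≤
      ∑ k, cliqueDiv (Real.log ((N : ℝ) * T)) τ (cell c k) p' p +
        stabilityBound c iStar τ p j := by
  have hL := twelve_le_log hNT
  set L := Real.log ((N : ℝ) * T)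
  have hτ0 : 0 < τ := by linarith
  have hpos := pos_of_mem_truncatedSimplex hNT hp
  have hpos' := pos_of_mem_truncatedSimplex hNT hp'
  have hM := mass_cell_pos hc hNT hp
  have hS := offCliqueSum_nonneg c iStar p
  have hDnn : ∀ k, 0 ≤ cliqueDiv L τ (cell c k) p' p := fun k =>
    cliqueDiv_nonneg hL hτ0.le (hc.nonempty k) (fun i _ => hpos i) (fun i _ => hpos' i)
  set P := mass p (cell c (c j)) with hPdef
  have hP : 0 < P := hM (c j)
  have hs : 0 < √P := Real.sqrt_pos.2 hP
  have hs1 : √P ≤ 1 := Real.sqrt_le_one.2 (mass_cell_le_one hp _)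
  by_cases hcase : c j = c iStar ∧ 9 / 10 ≤ P
  · obtain ⟨hcj, hP9⟩ := hcase
    have hshift : ∑ i, lossEstimate c p l j i * (p i - p' i) =
        ∑ k, ∑ i ∈ cell c k, (lossEstimate c p l j i - l iStar / P) * (p i - p' i) := by
      rw [sum_cell c fun i => (lossEstimate c p l j i - l iStar / P) * (p i - p' i)]
      simp only [sub_mul (lossEstimate c p l j _)]
      rw [Finset.sum_sub_distrib, ← Finset.mul_sum, Finset.sum_sub_distrib, hp.2.1, hp'.2.1]
      ring
    have hstar : ∑ i ∈ cell c (c iStar), (lossEstimate c p l j i - l iStar / P) * (p i - p' i) ≤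
        cliqueDiv L τ (cell c (c iStar)) p' p +
          8 * √(mass p ((cell c (c iStar)).erase iStar)) / τ := by
      have hval : ∀ i ∈ cell c (c iStar), lossEstimate c p l j i - l iStar / P =
          (l i - l iStar) / P := fun i hi => by
        have hci : c i = c iStar := by simpa [cell] using hi
        rw [lossEstimate, if_pos (by rwa [hcj]), hci, ← hcj, sub_div]
      refine stability_of_loss_vanishing_at hL hτ (mem_cell_self c iStar) (fun i _ => hpos i)
        (fun i _ => hpos' i) (mass_cell_le_one hp _) (mass_cell_le_one hp' _)
        (by rwa [← hcj]) ?_ fun i hi => ?_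
      · rw [hval _ (mem_cell_self c iStar), sub_self, zero_div]
      · rw [hval i hi, abs_div, abs_of_pos hP, hPdef, hcj]
        have : |l i - l iStar| ≤ 1 :=
          abs_le.2 ⟨by linarith [(hl i).1, (hl iStar).2], by linarith [(hl i).2, (hl iStar).1]⟩
        exact div_le_div_of_nonneg_right this (hM _).le
    have hoff : ∀ k ∈ Finset.univ.erase (c iStar),
        ∑ i ∈ cell c k, (lossEstimate c p l j i - l iStar / P) * (p i - p' i) ≤
        cliqueDiv L τ (cell c k) p' p + √(mass p (cell c k)) / τ := fun k hk => by
      have hval : ∀ i ∈ cell c k, lossEstimate c p l j i = 0 := fun i hi => by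
        have hci : c i = k := by simpa [cell] using hi
        rw [lossEstimate, if_neg]
        intro h
        have hci' : c i = c j := by simpa [cell] using h
        exact Finset.ne_of_mem_erase hk (by rw [← hci, hci', hcj])
      have heq : ∑ i ∈ cell c k, (lossEstimate c p l j i - l iStar / P) * (p i - p' i) =
          l iStar / P * (mass p' (cell c k) - mass p (cell c k)) := by
        unfold mass
        rw [← Finset.sum_sub_distrib, Finset.mul_sum]
        refine Finset.sum_congr rfl fun i hi => ?_
        rw [hval i hi]
        ring
      rw [heq]
      refine stability_of_const_loss hL hτ (hc.nonempty k) (fun i _ => hpos i)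
        (fun i _ => hpos' i) (mass_cell_le_one hp _) (div_nonneg (hl iStar).1 hP.le) ?_
      rw [div_le_iff₀ hP]
      linarith [(hl iStar).2]
    rw [hshift, ← Finset.add_sum_erase _ _ (Finset.mem_univ (c iStar)),
      ← Finset.add_sum_erase Finset.univ (fun k => cliqueDiv L τ (cell c k) p' p)
        (Finset.mem_univ (c iStar))]
    have hoffsum := Finset.sum_le_sum hoff
    rw [Finset.sum_add_distrib, ← Finset.sum_div] at hoffsum
    change _ ≤ _ + offCliqueSum c iStar p / τ at hoffsum
    have hB : (offCliqueSum c iStar p + 8 * √(mass p ((cell c (c iStar)).erase iStar))) / τ ≤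
        stabilityBound c iStar τ p j := by
      unfold stabilityBound
      rw [if_pos hcj, ← hPdef, div_eq_mul_one_div, mul_comm]
      refine mul_le_mul ?_ ?_ (by positivity) (by positivity)
      · exact one_div_le_one_div_of_le (by positivity) (by nlinarith)
      · linarith
    rw [add_div] at hB
    linarith
  · have hA : ∑ i ∈ cell c (c j), l i / P * (p i - p' i) ≤
        cliqueDiv L τ (cell c (c j)) p' p + 2 / (τ * √P) :=
      stability_of_nonneg_loss hL hτ0 (hc.nonempty _) (fun i _ => hpos i) (fun i _ => hpos' i)
        (fun i _ => div_nonneg (hl i).1 hP.le)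
        (fun i _ => div_le_div_of_nonneg_right (hl i).2 hP.le)
    rw [sum_lossEstimate_mul c p l j fun i => p i - p' i]
    have hD := Finset.single_le_sum (f := fun k => cliqueDiv L τ (cell c k) p' p)
      (fun k _ => hDnn k) (Finset.mem_univ (c j))
    have hB : 2 / (τ * √P) ≤ stabilityBound c iStar τ p j := by
      unfold stabilityBound
      rw [← hPdef, div_eq_mul_one_div, mul_comm]
      refine mul_le_mul_of_nonneg_left ?_ (by positivity)
      split_ifs with hcj
      · -- off the clique of `iStar` there is mass at least `1 / 10`
        have h1 : P < 9 / 10 := by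
          by_contra h
          exact hcase ⟨hcj, not_lt.1 h⟩
        have h2 := one_sub_mass_le_offCliqueSum (c := c) hp iStar
        rw [← hcj] at h2
        have h3 := Real.sqrt_nonneg (mass p ((cell c (c iStar)).erase iStar))
        linarith
      · exact le_rfl
    linarith

/-- The mean of the stability bound when the arm is drawn from `p`. -/
theorem sum_mul_stabilityBound_le {G : SimpleGraph (Fin N)} (hc : IsCliqueCovering G c)
    (hNT : 3 ^ 11 ≤ N * T) {τ : ℝ} (hτ : 0 < τ) {p : Fin N → ℝ}
    (hp : p ∈ truncatedSimplex N (gammaParam N T)) (iStar : Fin N) :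
    ∑ j, p j * stabilityBound c iStar τ p j ≤
      (22 * offCliqueSum c iStar p + 8 * √(mass p ((cell c (c iStar)).erase iStar))) / τ := by
  have hS := offCliqueSum_nonneg c iStar p
  set w := √(mass p ((cell c (c iStar)).erase iStar)) with hw
  have hw0 : 0 ≤ w := Real.sqrt_nonneg _
  have hk : ∀ k, ∑ j ∈ cell c k, p j * stabilityBound c iStar τ p j =
      √(mass p (cell c k)) / τ *
        if k = c iStar then 20 * offCliqueSum c iStar p + 8 * w else 2 := fun k => by
    have hM := mass_cell_pos hc hNT hp k
    have : ∀ j ∈ cell c k, p j * stabilityBound c iStar τ p j =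
        p j * (1 / (τ * √(mass p (cell c k))) *
          if k = c iStar then 20 * offCliqueSum c iStar p + 8 * w else 2) := fun j hj => by
      have hcj : c j = k := by simpa [cell] using hj
      rw [stabilityBound, hcj]
    rw [Finset.sum_congr rfl this, ← Finset.sum_mul]
    change mass p (cell c k) * _ = _
    rw [← mul_assoc]
    congr 1
    nth_rewrite 1 [← Real.mul_self_sqrt hM.le]
    have := Real.sqrt_pos.2 hM
    field_simp
  rw [← sum_cell c, Finset.sum_congr rfl fun k _ => hk k,
    ← Finset.add_sum_erase _ _ (Finset.mem_univ (c iStar)), if_pos rfl]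
  have hoff : ∑ k ∈ Finset.univ.erase (c iStar), (√(mass p (cell c k)) / τ *
      if k = c iStar then 20 * offCliqueSum c iStar p + 8 * w else 2) =
      2 * offCliqueSum c iStar p / τ := by
    have h : ∀ k ∈ Finset.univ.erase (c iStar), (√(mass p (cell c k)) / τ *
        if k = c iStar then 20 * offCliqueSum c iStar p + 8 * w else 2) =
        2 / τ * √(mass p (cell c k)) := fun k hk => by
      rw [if_neg (Finset.ne_of_mem_erase hk)]
      ring
    rw [Finset.sum_congr rfl h, ← Finset.mul_sum, div_mul_eq_mul_div]
    rfl
  rw [hoff]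
  have h1 : √(mass p (cell c (c iStar))) / τ ≤ 1 / τ :=
    div_le_div_of_nonneg_right (Real.sqrt_le_one.2 (mass_cell_le_one hp _)) hτ.le
  have h2 := mul_le_mul_of_nonneg_right h1
    (by positivity : 0 ≤ 20 * offCliqueSum c iStar p + 8 * w)
  calc _ ≤ 1 / τ * (20 * offCliqueSum c iStar p + 8 * w) + 2 * offCliqueSum c iStar p / τ := by
        linarith
    _ = _ := by ring

/-- Self-bounding of the Tsallis-Shannon entropy: `-Ψ(p)` exceeds `α` by a quantity that vanishes
as `p` concentrates on `iStar`, while `Ψ ≤ -α` everywhere. -/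
theorem tsallisShannon_sub_le {G : SimpleGraph (Fin N)} (hc : IsCliqueCovering G c)
    (hNT : 3 ^ 11 ≤ N * T) {p u : Fin N → ℝ}
    (hp : p ∈ truncatedSimplex N (gammaParam N T)) (hu : u ∈ truncatedSimplex N (gammaParam N T))
    (iStar : Fin N) :
    tsallisShannon (alphaParam N T) c u - tsallisShannon (alphaParam N T) c p ≤
      (alphaParam N T + Real.log ((N : ℝ) * T)) * offCliqueSum c iStar p +
        (Real.log ((N : ℝ) * T) + 1) * √(mass p ((cell c (c iStar)).erase iStar)) := by
  have hL := twelve_le_log hNT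
  have hα : 0 ≤ alphaParam N T := by unfold alphaParam; positivity
  set α := alphaParam N T
  have hlog := fun {q : Fin N → ℝ} (hq : q ∈ truncatedSimplex N (gammaParam N T)) =>
    neg_log_le_log_cond hc hNT hq
  set L := Real.log ((N : ℝ) * T)
  have hpos := pos_of_mem_truncatedSimplex hNT hp
  have hupos := pos_of_mem_truncatedSimplex hNT hu
  have hu1 : tsallisShannon α c u ≤ -α := by
    have hsum : 1 ≤ ∑ k, √(mass u (cell c k)) := by
      rw [← hu.2.1, ← sum_mass_cell c u]
      refine Finset.sum_le_sum fun k _ => Real.le_sqrt_of_sq_le ?_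
      nlinarith [mass_cell_le_one (c := c) hu k, mass_cell_pos hc hNT hu k]
    have : tsallisShannon α c u ≤ ∑ k, √(mass u (cell c k)) * -α := by
      rw [tsallisShannon_eq_sum]
      refine Finset.sum_le_sum fun k _ => ?_
      rw [cliqueEntropy_eq α (hc.nonempty k) fun i _ => hupos i]
      have hH := entropy_nonneg (cond_pos fun i (_ : i ∈ cell c k) => hupos i)
        (cond_le_one fun i _ => hupos i)
      have := mul_nonneg (Real.sqrt_nonneg (mass u (cell c k))) hH
      linarith
    rw [← Finset.sum_mul] at this
    nlinarith
  have hp1 : -tsallisShannon α c p = ∑ k, √(mass p (cell c k)) *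
      (α + entropy (cell c k) (cond p (cell c k))) := by
    rw [tsallisShannon_eq_sum, ← Finset.sum_neg_distrib]
    refine Finset.sum_congr rfl fun k _ => ?_
    rw [cliqueEntropy_eq α (hc.nonempty k) fun i _ => hpos i]
    ring
  have hoff : ∑ k ∈ Finset.univ.erase (c iStar), √(mass p (cell c k)) *
      (α + entropy (cell c k) (cond p (cell c k))) ≤ (α + L) * offCliqueSum c iStar p := by
    unfold offCliqueSum
    rw [Finset.mul_sum]
    refine Finset.sum_le_sum fun k _ => ?_
    rw [mul_comm]
    refine mul_le_mul_of_nonneg_right ?_ (Real.sqrt_nonneg _)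
    have := entropy_le (L := L) (cond_pos fun i (_ : i ∈ cell c k) => hpos i)
      (fun i _ => hlog hp k i) (sum_cond (hc.nonempty k) fun i _ => hpos i)
    linarith
  rw [← Finset.add_sum_erase _ _ (Finset.mem_univ (c iStar))] at hp1
  set V := cell c (c iStar) with hV
  have hiV : iStar ∈ V := mem_cell_self c iStar
  have hposV : ∀ i ∈ V, 0 < p i := fun i _ => hpos i
  have hent := entropy_le_mul_sum_erase (L := L) hiV (cond_pos hposV)
    (fun i _ => hlog hp (c iStar) i) (sum_cond ⟨_, hiV⟩ hposV)
  set x := ∑ i ∈ V.erase iStar, cond p V i with hx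
  have hx0 : 0 ≤ x :=
    Finset.sum_nonneg fun i hi => (cond_pos hposV i (Finset.mem_of_mem_erase hi)).le
  have hx1 : x ≤ 1 := by
    have := Finset.add_sum_erase V (cond p V) hiV
    rw [sum_cond ⟨_, hiV⟩ hposV] at this
    linarith [cond_pos hposV iStar hiV]
  have hM : 0 < mass p V := mass_pos ⟨_, hiV⟩ hposV
  have hM1 : mass p V ≤ 1 := mass_cell_le_one hp _
  have hPx : mass p (V.erase iStar) = mass p V * x := by
    rw [hx, Finset.mul_sum]
    exact Finset.sum_congr rfl fun i hi => (mul_cond hposV i (Finset.mem_of_mem_erase hi)).symm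
  have hsx : √(mass p V) * x ≤ √(mass p (V.erase iStar)) := by
    refine Real.le_sqrt_of_sq_le ?_
    rw [hPx, mul_pow, Real.sq_sqrt hM.le]
    exact mul_le_mul_of_nonneg_left (by nlinarith) hM.le
  have hs1 : √(mass p V) ≤ 1 := Real.sqrt_le_one.2 hM1
  have h1 : √(mass p V) * (α + entropy V (cond p V)) ≤
      α + (L + 1) * √(mass p (V.erase iStar)) := by
    have a1 := mul_le_mul_of_nonneg_left hent (Real.sqrt_nonneg (mass p V))
    have a2 := mul_le_mul_of_nonneg_left hsx (by linarith : 0 ≤ L + 1)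
    have a3 := mul_le_mul_of_nonneg_right hs1 hα
    linarith
  linarith

theorem cumEstimate_succ (l : ℕ → Fin N → ℝ) (a : ℕ → Fin N) (t : ℕ) :
    cumEstimate T c l a (t + 1) = cumEstimate T c l a t +
      lossEstimate c (prediction T c l a (t + 1)) (l (t + 1)) (a (t + 1)) := rfl

theorem sum_cumEstimate_mul (l : ℕ → Fin N → ℝ) (a : ℕ → Fin N) (u : Fin N → ℝ) (n : ℕ) :
    ∑ i, cumEstimate T c l a n i * u i = ∑ t ∈ Finset.Icc 1 n,
      ∑ i, lossEstimate c (prediction T c l a t) (l t) (a t) i * u i := by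
  induction n with
  | zero => simp [cumEstimate]
  | succ n ih =>
    rw [Finset.sum_Icc_succ_top (by omega), ← ih, cumEstimate_succ, ← Finset.sum_add_distrib]
    exact Finset.sum_congr rfl fun i _ => by rw [Pi.add_apply, add_mul]

theorem objective_add (t : ℕ) (Λ Λ' p : Fin N → ℝ) :
    objective T c t (Λ + Λ') p = objective T c t Λ p + ∑ i, Λ' i * p i := by
  unfold objective
  simp only [Pi.add_apply, add_mul]
  rw [Finset.sum_add_distrib]
  ring

theorem objective_succ (t : ℕ) (Λ p : Fin N → ℝ) :
    objective T c (t + 1) Λ p = objective T c t Λ p +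
      (√((t + 1 : ℕ) : ℝ) - √(t : ℝ)) * tsallisShannon (alphaParam N T) c p := by
  unfold objective regularizer
  rw [stepSize_inv, stepSize_inv]
  ring

theorem logBarrier_nonneg {G : SimpleGraph (Fin N)} (hc : IsCliqueCovering G c)
    (hNT : 3 ^ 11 ≤ N * T) {p : Fin N → ℝ}
    (hp : p ∈ truncatedSimplex N (gammaParam N T)) : 0 ≤ logBarrier 9 c p := by
  unfold logBarrier
  have : ∑ k, Real.log (mass p (cell c k)) ≤ 0 := Finset.sum_nonpos fun k _ =>
    Real.log_nonpos (mass_cell_pos hc hNT hp k).le (mass_cell_le_one hp k)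
  linarith

/-- The telescoping step of follow-the-regularized-leader. -/
theorem sum_le_objective_predictionPlus {G : SimpleGraph (Fin N)} (hc : IsCliqueCovering G c)
    (hNT : 3 ^ 11 ≤ N * T) {l : ℕ → Fin N → ℝ} (a : ℕ → Fin N)
    (hl : ∀ t ∈ Finset.Icc 1 T, ∀ i, l t i ∈ Set.Icc (0 : ℝ) 1) (iStar : Fin N) (n : ℕ)
    (hn : n ≤ T) :
    ∑ t ∈ Finset.Icc 1 n,
      (∑ i, lossEstimate c (prediction T c l a t) (l t) (a t) i * prediction T c l a t i +
        (√(t : ℝ) - √((t - 1 : ℕ) : ℝ)) *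
          tsallisShannon (alphaParam N T) c (prediction T c l a t) -
        stabilityBound c iStar √(t : ℝ) (prediction T c l a t) (a t)) ≤
      objective T c n (cumEstimate T c l a n) (predictionPlus T c l a n) := by
  have h0 : 0 < N * T := by omega
  have hN : 0 < N := Nat.pos_of_mul_pos_right h0
  have hT : 0 < T := Nat.pos_of_mul_pos_left h0
  have hspec := fun t Λ => ftrlPoint_spec hc hN hT (c := c) t Λ
  induction n with
  | zero =>
    have h := logBarrier_nonneg hc hNT (hspec 0 (cumEstimate T c l a 0)).1
    simp only [objective, regularizer, stepSize_inv, predictionPlus, cumEstimate] at h ⊢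
    simpa using h
  | succ n ih =>
    rw [Finset.sum_Icc_succ_top (by omega), Nat.add_sub_cancel]
    have ih := ih (by omega)
    have hp : prediction T c l a (n + 1) = ftrlPoint T c (n + 1) (cumEstimate T c l a n) := rfl
    have hpS := hspec (n + 1) (cumEstimate T c l a n)
    rw [← hp] at hpS
    have hqS := hspec (n + 1) (cumEstimate T c l a (n + 1))
    have hq : predictionPlus T c l a (n + 1) =
      ftrlPoint T c (n + 1) (cumEstimate T c l a (n + 1)) := rfl
    rw [← hq] at hqS
    have hpp := hspec n (cumEstimate T c l a n)
    have hbreg := sum_cliqueDiv_le_objective_sub hc hNT (n + 1) (cumEstimate T c l a n) hpS.1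
      hqS.1 hpS.2
    have hτ : (1 : ℝ) ≤ √((n + 1 : ℕ) : ℝ) := by
      rw [Real.one_le_sqrt]; push_cast; linarith [n.cast_nonneg (α := ℝ)]
    have hstab := stability_le hc hNT hτ hpS.1 hqS.1
      (hl (n + 1) (Finset.mem_Icc.2 ⟨by omega, hn⟩)) iStar (a (n + 1))
    have hmono : objective T c n (cumEstimate T c l a n) (predictionPlus T c l a n) ≤
      objective T c n (cumEstimate T c l a n) (prediction T c l a (n + 1)) := hpp.2 hpS.1
    rw [cumEstimate_succ, objective_add]
    rw [objective_succ n _ (prediction T c l a (n + 1))] at hbreg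
    simp only [mul_sub] at hstab
    rw [Finset.sum_sub_distrib] at hstab
    linarith

theorem sqrt_sub_sqrt_pred_le {t : ℕ} (ht : 1 ≤ t) :
    √(t : ℝ) - √((t - 1 : ℕ) : ℝ) ≤ 1 / √(t : ℝ) := by
  have ht' : (1 : ℝ) ≤ t := by exact_mod_cast ht
  have hs : 0 < √(t : ℝ) := Real.sqrt_pos.2 (by linarith)
  rw [le_div_iff₀ hs, Nat.cast_sub ht, Nat.cast_one]
  have h1 := Real.sq_sqrt (by linarith : (0 : ℝ) ≤ t)
  have h2 := Real.sq_sqrt (by linarith : (0 : ℝ) ≤ (t : ℝ) - 1)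
  have h3 : √((t : ℝ) - 1) ≤ √(t : ℝ) := Real.sqrt_le_sqrt (by linarith)
  nlinarith [Real.sqrt_nonneg ((t : ℝ) - 1)]

theorem sum_sqrt_sub_sqrt_pred (n : ℕ) :
    ∑ t ∈ Finset.Icc 1 n, (√(t : ℝ) - √((t - 1 : ℕ) : ℝ)) = √(n : ℝ) := by
  induction n with
  | zero => simp
  | succ n ih => rw [Finset.sum_Icc_succ_top (by omega), ih, Nat.add_sub_cancel]; ring

/-- The regret of the algorithm on its own loss estimates, along every sample path. -/
theorem pathwise_regret_le {G : SimpleGraph (Fin N)} (hc : IsCliqueCovering G c)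
    (hNT : 3 ^ 11 ≤ N * T) {l : ℕ → Fin N → ℝ} (a : ℕ → Fin N)
    (hl : ∀ t ∈ Finset.Icc 1 T, ∀ i, l t i ∈ Set.Icc (0 : ℝ) 1) (iStar : Fin N)
    {u : Fin N → ℝ} (hu : u ∈ truncatedSimplex N (gammaParam N T)) :
    ∑ t ∈ Finset.Icc 1 T, ∑ i, lossEstimate c (prediction T c l a t) (l t) (a t) i *
        (prediction T c l a t i - u i) ≤
      logBarrier 9 c u + ∑ t ∈ Finset.Icc 1 T,
        (stabilityBound c iStar √(t : ℝ) (prediction T c l a t) (a t) +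
          ((alphaParam N T + Real.log ((N : ℝ) * T)) * offCliqueSum c iStar (prediction T c l a t) +
            (Real.log ((N : ℝ) * T) + 1) *
              √(mass (prediction T c l a t) ((cell c (c iStar)).erase iStar))) / √(t : ℝ)) := by
  have h0 : 0 < N * T := by omega
  have hN : 0 < N := Nat.pos_of_mul_pos_right h0
  have hT : 0 < T := Nat.pos_of_mul_pos_left h0
  have hL := twelve_le_log hNT
  have htel := sum_le_objective_predictionPlus hc hNT a hl iStar T le_rfl
  have hmin : objective T c T (cumEstimate T c l a T) (predictionPlus T c l a T) ≤
    objective T c T (cumEstimate T c l a T) u := (ftrlPoint_spec hc hN hT T _).2 hu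
  have hobj : objective T c T (cumEstimate T c l a T) u =
      ∑ t ∈ Finset.Icc 1 T,
        (∑ i, lossEstimate c (prediction T c l a t) (l t) (a t) i * u i +
          (√(t : ℝ) - √((t - 1 : ℕ) : ℝ)) * tsallisShannon (alphaParam N T) c u) +
        logBarrier 9 c u := by
    unfold objective regularizer
    rw [stepSize_inv, sum_cumEstimate_mul, Finset.sum_add_distrib, ← Finset.sum_mul,
      sum_sqrt_sub_sqrt_pred]
    ring
  rw [hobj] at hmin
  have hterm : ∀ t ∈ Finset.Icc 1 T, ∑ i, lossEstimate c (prediction T c l a t) (l t) (a t) i *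
        (prediction T c l a t i - u i) -
      (stabilityBound c iStar √(t : ℝ) (prediction T c l a t) (a t) +
          ((alphaParam N T + Real.log ((N : ℝ) * T)) * offCliqueSum c iStar (prediction T c l a t) +
            (Real.log ((N : ℝ) * T) + 1) *
              √(mass (prediction T c l a t) ((cell c (c iStar)).erase iStar))) / √(t : ℝ)) ≤
      (∑ i, lossEstimate c (prediction T c l a t) (l t) (a t) i * prediction T c l a t i +
        (√(t : ℝ) - √((t - 1 : ℕ) : ℝ)) *
          tsallisShannon (alphaParam N T) c (prediction T c l a t) -
        stabilityBound c iStar √(t : ℝ) (prediction T c l a t) (a t)) -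
      (∑ i, lossEstimate c (prediction T c l a t) (l t) (a t) i * u i +
          (√(t : ℝ) - √((t - 1 : ℕ) : ℝ)) * tsallisShannon (alphaParam N T) c u) := by
    intro t ht
    have hpS : prediction T c l a t ∈ truncatedSimplex N (gammaParam N T) :=
      (ftrlPoint_spec hc hN hT t _).1
    have hpen := tsallisShannon_sub_le hc hNT hpS hu iStar
    set X := (alphaParam N T + Real.log ((N : ℝ) * T)) * offCliqueSum c iStar (prediction T c l a t) +
            (Real.log ((N : ℝ) * T) + 1) *
              √(mass (prediction T c l a t) ((cell c (c iStar)).erase iStar)) with hX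
    have hX0 : 0 ≤ X := by
      have := offCliqueSum_nonneg c iStar (prediction T c l a t)
      have : 0 ≤ alphaParam N T := by unfold alphaParam; positivity
      positivity
    have hd0 : 0 ≤ √(t : ℝ) - √((t - 1 : ℕ) : ℝ) :=
      sub_nonneg.2 (Real.sqrt_le_sqrt (by exact_mod_cast Nat.sub_le t 1))
    have hd1 := sqrt_sub_sqrt_pred_le (Finset.mem_Icc.1 ht).1
    have e1 := mul_le_mul_of_nonneg_left hpen hd0
    have e2 := mul_le_mul_of_nonneg_right hd1 hX0
    rw [one_div_mul_eq_div] at e2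
    simp only [mul_sub (lossEstimate _ _ _ _ _)]
    rw [Finset.sum_sub_distrib]
    linarith
  have hsum := Finset.sum_le_sum hterm
  rw [Finset.sum_sub_distrib, Finset.sum_sub_distrib (f := fun t => (∑ i, lossEstimate c
    (prediction T c l a t) (l t) (a t) i * prediction T c l a t i +
        (√(t : ℝ) - √((t - 1 : ℕ) : ℝ)) *
          tsallisShannon (alphaParam N T) c (prediction T c l a t) -
        stabilityBound c iStar √(t : ℝ) (prediction T c l a t) (a t)))] at hsum
  linarith

end Pathwise

/-! ### Expectations over the random draw -/

section Draw

variable {Ω : Type*} {N : ℕ}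

/-- If `J` has conditional law `q` given `m`, then averaging an `m`-measurable family over the
draw of `J` amounts to averaging it against `q`. -/
theorem integral_draw {m m0 : MeasurableSpace Ω} {P : Measure Ω} [IsProbabilityMeasure P]
    (hm : m ≤ m0) {J : Ω → Fin N} (hJ : Measurable J) {q : Ω → Fin N → ℝ}
    (hq : ∀ j, P[Set.indicator {ω | J ω = j} (fun _ => (1 : ℝ)) | m] =ᵐ[P] fun ω => q ω j)
    {g : Fin N → Ω → ℝ} (hg : ∀ j, AEStronglyMeasurable[m] (g j) P) {C : ℝ}
    (hC : ∀ j ω, |g j ω| ≤ C) :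
    Integrable (fun ω => g (J ω) ω) P ∧ Integrable (fun ω => ∑ j, q ω j * g j ω) P ∧
      ∫ ω, g (J ω) ω ∂P = ∫ ω, ∑ j, q ω j * g j ω ∂P := by
  have hset : ∀ j, MeasurableSet {ω | J ω = j} := fun j => hJ (measurableSet_singleton j)
  have hint1 : ∀ j, Integrable (Set.indicator {ω | J ω = j} (fun _ => (1 : ℝ))) P := fun j =>
    (integrable_const 1).indicator (hset j)
  have hgi : ∀ j, AEStronglyMeasurable (g j) P := fun j => (hg j).mono hm
  have hprod : ∀ j, Integrable (g j * Set.indicator {ω | J ω = j} (fun _ => (1 : ℝ))) P := fun j =>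
    (hint1 j).bdd_mul (hgi j) (Filter.Eventually.of_forall fun ω => hC j ω)
  have hpull : ∀ j, P[g j * Set.indicator {ω | J ω = j} (fun _ => (1 : ℝ)) | m] =ᵐ[P]
      fun ω => q ω j * g j ω := fun j => by
    filter_upwards [condExp_mul_of_aestronglyMeasurable_left (hg j) (hprod j) (hint1 j), hq j]
      with ω h1 h2
    rw [h1, Pi.mul_apply, h2, mul_comm]
  have hqi : ∀ j, Integrable (fun ω => q ω j * g j ω) P := fun j =>
    (integrable_condExp).congr (hpull j)
  have heq : (fun ω => g (J ω) ω) =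
      fun ω => ∑ j, (g j * Set.indicator {ω | J ω = j} (fun _ => (1 : ℝ))) ω := by
    funext ω
    rw [Finset.sum_eq_single (J ω)]
    · simp
    · intro j _ hj
      simp [Set.indicator, hj.symm]
    · simp
  refine ⟨?_, integrable_finsetSum _ fun j _ => hqi j, ?_⟩
  · rw [heq]
    exact integrable_finsetSum _ fun j _ => hprod j
  · rw [heq, integral_finsetSum _ fun j _ => hprod j, integral_finsetSum _ fun j _ => hqi j]
    refine Finset.sum_congr rfl fun j _ => ?_
    rw [← integral_condExp hm]
    exact integral_congr_ae (hpull j)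

theorem integral_sqrt_le {m0 : MeasurableSpace Ω} {P : Measure Ω} [IsProbabilityMeasure P]
    {X : Ω → ℝ} (hX : AEStronglyMeasurable X P) (h0 : ∀ ω, 0 ≤ X ω) (h1 : ∀ ω, X ω ≤ 1) :
    ∫ ω, √(X ω) ∂P ≤ √(∫ ω, X ω ∂P) := by
  have hi : Integrable X P := Integrable.of_bound hX 1 (Filter.Eventually.of_forall fun ω => by
    rw [Real.norm_eq_abs, abs_of_nonneg (h0 ω)]; exact h1 ω)
  have hs : Integrable (Real.sqrt ∘ X) P := Integrable.of_bound
    (Real.continuous_sqrt.comp_aestronglyMeasurable hX) 1 (Filter.Eventually.of_forall fun ω => by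
      rw [Real.norm_eq_abs, Function.comp_apply, abs_of_nonneg (Real.sqrt_nonneg _)]
      exact Real.sqrt_le_one.2 (h1 ω))
  exact Real.strictConcaveOn_sqrt.concaveOn.le_map_integral Real.continuous_sqrt.continuousOn
    isClosed_Ici (Filter.Eventually.of_forall h0) hi hs

end Draw

section Estimator

variable {N K T : ℕ} {c : Fin N → Fin K}

/-- The loss estimator is unbiased. -/
theorem sum_mul_sum_lossEstimate {p : Fin N → ℝ} (hM : ∀ k, 0 < mass p (cell c k))
    (l f : Fin N → ℝ) :
    ∑ j, p j * ∑ i, lossEstimate c p l j i * f i = ∑ i, l i * f i := by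
  rw [← sum_cell c fun i => l i * f i, ← sum_cell c]
  refine Finset.sum_congr rfl fun k _ => ?_
  have h : ∀ j ∈ cell c k, p j * ∑ i, lossEstimate c p l j i * f i =
      p j * ((∑ i ∈ cell c k, l i * f i) / mass p (cell c k)) := fun j hj => by
    have hcj : c j = k := by simpa [cell] using hj
    rw [sum_lossEstimate_mul, hcj, Finset.sum_div]
    congr 1
    exact Finset.sum_congr rfl fun i _ => by ring
  rw [Finset.sum_congr rfl h, ← Finset.sum_mul]
  change mass p (cell c k) * _ = _
  exact mul_div_cancel₀ _ (hM k).ne'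

theorem measurable_mass (V : Finset (Fin N)) : Measurable fun p : Fin N → ℝ => mass p V := by
  unfold mass
  fun_prop

theorem measurable_lossEstimate (c : Fin N → Fin K) (i j : Fin N) :
    Measurable fun x : (Fin N → ℝ) × (Fin N → ℝ) => lossEstimate c x.1 x.2 j i := by
  unfold lossEstimate
  split_ifs
  · exact ((measurable_pi_apply i).comp measurable_snd).div
      ((measurable_mass _).comp measurable_fst)
  · exact measurable_const

theorem measurable_offCliqueSum (c : Fin N → Fin K) (iStar : Fin N) :
    Measurable (offCliqueSum c iStar) := by
  unfold offCliqueSum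
  exact Finset.measurable_fun_sum _ fun k _ => (measurable_mass _).sqrt

theorem measurable_stabilityBound (c : Fin N → Fin K) (iStar : Fin N) (τ : ℝ) (j : Fin N) :
    Measurable fun p => stabilityBound c iStar τ p j := by
  unfold stabilityBound
  refine Measurable.mul (measurable_const.div (measurable_const.mul (measurable_mass _).sqrt)) ?_
  split_ifs
  · exact (measurable_const.mul (measurable_offCliqueSum c iStar)).add
      (measurable_const.mul (measurable_mass _).sqrt)
  · exact measurable_const

theorem gammaParam_le_mass_cell {p : Fin N → ℝ} {G : SimpleGraph (Fin N)}
    (hc : IsCliqueCovering G c) (hp : p ∈ truncatedSimplex N (gammaParam N T)) (k : Fin K) :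
    gammaParam N T ≤ mass p (cell c k) := by
  obtain ⟨i, hi⟩ := hc.nonempty k
  exact (hp.2.2 i).trans (Finset.single_le_sum (f := p) (fun j _ => hp.1 j) hi)

theorem apply_le_one {γ : ℝ} {p : Fin N → ℝ} (hp : p ∈ truncatedSimplex N γ) (i : Fin N) :
    p i ≤ 1 := by
  rw [← hp.2.1]
  exact Finset.single_le_sum (f := p) (fun j _ => hp.1 j) (Finset.mem_univ i)

theorem mass_nonneg {γ : ℝ} {p : Fin N → ℝ} (hp : p ∈ truncatedSimplex N γ)
    (A : Finset (Fin N)) : 0 ≤ mass p A := Finset.sum_nonneg fun i _ => hp.1 i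

theorem offCliqueSum_le {γ : ℝ} {p : Fin N → ℝ} (hp : p ∈ truncatedSimplex N γ)
    (iStar : Fin N) : offCliqueSum c iStar p ≤ K := by
  calc offCliqueSum c iStar p ≤ ∑ k : Fin K, (1 : ℝ) := by
        refine (Finset.sum_le_sum_of_subset_of_nonneg (Finset.erase_subset _ _)
          fun _ _ _ => Real.sqrt_nonneg _).trans ?_
        exact Finset.sum_le_sum fun k _ => Real.sqrt_le_one.2 (mass_cell_le_one hp k)
    _ = K := by simp

theorem abs_sum_lossEstimate_le {G : SimpleGraph (Fin N)} (hc : IsCliqueCovering G c)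
    (hNT : 3 ^ 11 ≤ N * T) {p u l : Fin N → ℝ} (hp : p ∈ truncatedSimplex N (gammaParam N T))
    (hu : u ∈ truncatedSimplex N (gammaParam N T)) (hl : ∀ i, l i ∈ Set.Icc (0 : ℝ) 1)
    (j : Fin N) :
    |∑ i, lossEstimate c p l j i * (p i - u i)| ≤ N * (1 / gammaParam N T) := by
  have hγ := gammaParam_pos hNT
  calc |∑ i, lossEstimate c p l j i * (p i - u i)| ≤ ∑ i : Fin N, 1 / gammaParam N T := by
        refine (Finset.abs_sum_le_sum_abs _ _).trans (Finset.sum_le_sum fun i _ => ?_)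
        have h1 : |p i - u i| ≤ 1 := abs_le.2
          ⟨by linarith [hp.1 i, apply_le_one hu i], by linarith [hu.1 i, apply_le_one hp i]⟩
        have h2 : |lossEstimate c p l j i| ≤ 1 / gammaParam N T := by
          unfold lossEstimate
          split_ifs
          · rw [abs_of_nonneg (div_nonneg (hl i).1 (mass_nonneg hp _))]
            exact div_le_div₀ zero_le_one (hl i).2 hγ (gammaParam_le_mass_cell hc hp _)
          · rw [abs_zero]; positivity
        rw [abs_mul]
        calc _ ≤ 1 / gammaParam N T * 1 := mul_le_mul h2 h1 (abs_nonneg _) (by positivity)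
          _ = _ := mul_one _
    _ = N * (1 / gammaParam N T) := by simp

theorem abs_stabilityBound_le {G : SimpleGraph (Fin N)} (hc : IsCliqueCovering G c)
    (hNT : 3 ^ 11 ≤ N * T) {p : Fin N → ℝ} (hp : p ∈ truncatedSimplex N (gammaParam N T))
    {τ : ℝ} (hτ : 1 ≤ τ) (iStar j : Fin N) :
    |stabilityBound c iStar τ p j| ≤ 1 / √(gammaParam N T) * (20 * K + 8 + 2) := by
  have hγ := gammaParam_pos hNT
  have hS := offCliqueSum_nonneg c iStar p
  have hw := Real.sqrt_nonneg (mass p ((cell c (c iStar)).erase iStar))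
  have hsγ := Real.sqrt_pos.2 hγ
  have hle : √(gammaParam N T) ≤ τ * √(mass p (cell c (c j))) := by
    have := Real.sqrt_le_sqrt (gammaParam_le_mass_cell hc hp (c j))
    nlinarith
  unfold stabilityBound
  rw [abs_mul, abs_of_nonneg (a := 1 / (τ * √(mass p (cell c (c j))))) (by positivity)]
  refine mul_le_mul (one_div_le_one_div_of_le hsγ hle) ?_ (abs_nonneg _) (by positivity)
  split_ifs
  · rw [abs_of_nonneg (by positivity)]
    have h1 := offCliqueSum_le (c := c) hp iStar
    have h2 := Real.sqrt_le_one.2 (mass_le_one hp ((cell c (c iStar)).erase iStar))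
    linarith
  · rw [abs_of_nonneg (by norm_num)]
    linarith [K.cast_nonneg (α := ℝ)]

/-- The comparator: the vertex `j` of the simplex, mixed with the uniform distribution so as to
lie in the truncated simplex. -/
noncomputable def comparator (N T : ℕ) (j : Fin N) : Fin N → ℝ := fun i =>
  gammaParam N T + if i = j then 1 - N * gammaParam N T else 0

theorem natCast_mul_gammaParam (hNT : 3 ^ 11 ≤ N * T) : (N : ℝ) * gammaParam N T = 1 / T := by
  have hN : (N : ℝ) ≠ 0 := by
    rintro h
    have : N = 0 := by exact_mod_cast h
    subst this
    omega
  unfold gammaParam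
  field_simp

theorem comparator_mem (hNT : 3 ^ 11 ≤ N * T) (j : Fin N) :
    comparator N T j ∈ truncatedSimplex N (gammaParam N T) := by
  have hγ := gammaParam_pos hNT
  have hT : 0 < T := Nat.pos_of_mul_pos_left (by omega : 0 < N * T)
  have hT' : (1 : ℝ) ≤ T := by exact_mod_cast hT
  have h1 : (N : ℝ) * gammaParam N T ≤ 1 := by
    rw [natCast_mul_gammaParam hNT, div_le_one (by linarith)]
    exact hT'
  have h : ∀ i, gammaParam N T ≤ comparator N T j i := fun i => by
    unfold comparator
    split_ifs <;> linarith
  refine ⟨fun i => hγ.le.trans (h i), ?_, h⟩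
  unfold comparator
  rw [Finset.sum_add_distrib, Finset.sum_ite_eq' Finset.univ j]
  simp

theorem sum_mul_comparator_le (hNT : 3 ^ 11 ≤ N * T) {l : Fin N → ℝ}
    (hl : ∀ i, l i ∈ Set.Icc (0 : ℝ) 1) (j : Fin N) :
    ∑ i, l i * comparator N T j i ≤ l j + 1 / T := by
  have hγ := gammaParam_pos hNT
  unfold comparator
  simp only [mul_add, mul_ite, mul_zero]
  rw [Finset.sum_add_distrib, Finset.sum_ite_eq' Finset.univ j, ← Finset.sum_mul]
  have hs : ∑ i, l i ≤ N := by
    calc ∑ i, l i ≤ ∑ i : Fin N, (1 : ℝ) := Finset.sum_le_sum fun i _ => (hl i).2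
      _ = N := by simp
  have h1 := mul_le_mul_of_nonneg_right hs hγ.le
  rw [if_pos (Finset.mem_univ j)]
  have h2 : 0 ≤ l j * (N * gammaParam N T) :=
    mul_nonneg (hl j).1 (mul_nonneg (Nat.cast_nonneg N) hγ.le)
  rw [← natCast_mul_gammaParam hNT]
  linarith

/-- The barrier at the comparator falls short of `9 K log (N T)` by almost `9 log (N T)`, since
the clique of `j` has mass at least `1 / 2`; this pays for the bias of the comparator. -/
theorem logBarrier_comparator_add_one_le {G : SimpleGraph (Fin N)} (hc : IsCliqueCovering G c)
    (hNT : 3 ^ 11 ≤ N * T) (hT2 : 2 ≤ T) (j : Fin N) :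
    logBarrier 9 c (comparator N T j) + 1 ≤ 9 * K * Real.log ((N : ℝ) * T) := by
  have hγ := gammaParam_pos hNT
  have hu := comparator_mem hNT j
  have hL := twelve_le_log hNT
  have hlogγ : Real.log (gammaParam N T) = -Real.log ((N : ℝ) * T) := by
    unfold gammaParam
    rw [one_div, Real.log_inv]
  set L := Real.log ((N : ℝ) * T)
  have hk : ∀ k, -L ≤ Real.log (mass (comparator N T j) (cell c k)) := fun k => by
    rw [← hlogγ]
    exact Real.log_le_log hγ (gammaParam_le_mass_cell hc hu k)
  have hj : -Real.log 2 ≤ Real.log (mass (comparator N T j) (cell c (c j))) := by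
    rw [← Real.log_inv]
    refine Real.log_le_log (by norm_num) ?_
    have h1 : comparator N T j j ≤ mass (comparator N T j) (cell c (c j)) :=
      Finset.single_le_sum (f := comparator N T j) (fun i _ => hu.1 i) (mem_cell_self c j)
    refine le_trans ?_ h1
    have h2 : (1 : ℝ) / T ≤ 1 / 2 :=
      one_div_le_one_div_of_le (by norm_num) (by exact_mod_cast hT2)
    unfold comparator
    rw [if_pos rfl, natCast_mul_gammaParam hNT]
    linarith
  have hsum : ∑ k ∈ Finset.univ.erase (c j), (-L) ≤
      ∑ k ∈ Finset.univ.erase (c j), Real.log (mass (comparator N T j) (cell c k)) :=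
    Finset.sum_le_sum fun k _ => hk k
  have htot := Finset.add_sum_erase Finset.univ (fun _ : Fin K => -L) (Finset.mem_univ (c j))
  rw [show ∑ _k : Fin K, -L = -(K * L) by simp] at htot
  have htot2 := Finset.add_sum_erase Finset.univ
    (fun k => Real.log (mass (comparator N T j) (cell c k))) (Finset.mem_univ (c j))
  have := Real.log_two_lt_d9
  unfold logBarrier
  linarith

end Estimator

/-! ### The expected regret -/

section Regret

variable {Ω : Type*} {N K T : ℕ}
  {c : Fin N → Fin K} {lTilde l : ℕ → Ω → Fin N → ℝ} {μ : Fin N → ℝ} {I : ℕ → Ω → Fin N}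

theorem history_le [MeasurableSpace Ω] {P : Measure Ω}
    (hl : IsCorruptedStochastic P T lTilde l μ) (hI : IsPlayedBy P T c l I) {t : ℕ}
    (ht : t ∈ Finset.Icc 1 T) : history l I t ≤ ‹MeasurableSpace Ω› := by
  have htT := (Finset.mem_Icc.1 ht).2
  refine sup_le (iSup₂_le fun s hs => ?_) (iSup₂_le fun s hs => ?_)
  · exact (hI.measurable s (Finset.mem_Icc.2 ⟨hs.1, hs.2.le.trans htT⟩)).comap_le
  · exact (hl.measurable s (Finset.mem_Icc.2 ⟨hs.1, hs.2.trans htT⟩)).comap_le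

theorem measurable_history_loss {t : ℕ} (ht : 1 ≤ t) : Measurable[history l I t] (l t) := by
  have h : MeasurableSpace.comap (l t) inferInstance ≤ history l I t :=
    le_sup_of_le_right (le_iSup₂_of_le t (Set.mem_Icc.2 ⟨ht, le_rfl⟩) le_rfl)
  exact (comap_measurable (l t)).mono h le_rfl

/-- Being a version of a conditional law given the history, the prediction of round `t` is
measurable with respect to the history up to null sets; the current loss vector is as well. -/
theorem aestronglyMeasurable_history [MeasurableSpace Ω] {P : Measure Ω}
    (hI : IsPlayedBy P T c l I) {t : ℕ}
    (ht : t ∈ Finset.Icc 1 T) {φ : (Fin N → ℝ) × (Fin N → ℝ) → ℝ} (hφ : Measurable φ) :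
    AEStronglyMeasurable[history l I t] (fun ω =>
      φ (prediction T c (fun s => l s ω) (fun s => I s ω) t, l t ω)) P := by
  refine ⟨fun ω => φ (fun i => (P[Set.indicator {ω | I t ω = i} (fun _ => (1 : ℝ)) |
    history l I t]) ω, l t ω), ?_, ?_⟩
  · refine Measurable.stronglyMeasurable ?_
    refine hφ.comp (Measurable.prodMk ?_ (measurable_history_loss (Finset.mem_Icc.1 ht).1))
    exact @measurable_pi_lambda _ _ _ (history l I t) _ _ fun i =>
      stronglyMeasurable_condExp.measurable
  · filter_upwards [ae_all_iff.2 (hI.condLaw t ht)] with ω hω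
    simp only [hω]

/-- In round `t`, averaging over the arm amounts to averaging against the prediction. -/
theorem integral_draw_prediction [MeasurableSpace Ω] {P : Measure Ω} [IsProbabilityMeasure P]
    (hl : IsCorruptedStochastic P T lTilde l μ)
    (hI : IsPlayedBy P T c l I) {t : ℕ} (ht : t ∈ Finset.Icc 1 T)
    {φ : Fin N → (Fin N → ℝ) × (Fin N → ℝ) → ℝ} (hφ : ∀ j, Measurable (φ j)) {C : ℝ}
    (hC : ∀ j ω, |φ j (prediction T c (fun s => l s ω) (fun s => I s ω) t, l t ω)| ≤ C) :
    Integrable (fun ω => φ (I t ω)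
        (prediction T c (fun s => l s ω) (fun s => I s ω) t, l t ω)) P ∧
      Integrable (fun ω => ∑ j, prediction T c (fun s => l s ω) (fun s => I s ω) t j *
        φ j (prediction T c (fun s => l s ω) (fun s => I s ω) t, l t ω)) P ∧
      ∫ ω, φ (I t ω) (prediction T c (fun s => l s ω) (fun s => I s ω) t, l t ω) ∂P =
        ∫ ω, ∑ j, prediction T c (fun s => l s ω) (fun s => I s ω) t j *
          φ j (prediction T c (fun s => l s ω) (fun s => I s ω) t, l t ω) ∂P :=
  integral_draw (history_le hl hI ht) (hI.measurable t ht) (hI.condLaw t ht)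
    (g := fun j ω => φ j (prediction T c (fun s => l s ω) (fun s => I s ω) t, l t ω))
    (fun j => aestronglyMeasurable_history hI ht (hφ j)) hC

end Regret

section ExpectedRegret

variable {Ω : Type*} [MeasurableSpace Ω] {P : Measure Ω} [IsProbabilityMeasure P] {N K T : ℕ}
  {c : Fin N → Fin K} {lTilde l : ℕ → Ω → Fin N → ℝ} {μ : Fin N → ℝ} {I : ℕ → Ω → Fin N}

theorem prediction_mem {G : SimpleGraph (Fin N)} (hc : IsCliqueCovering G c)
    (hNT : 3 ^ 11 ≤ N * T) (l : ℕ → Fin N → ℝ) (a : ℕ → Fin N) (t : ℕ) :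
    prediction T c l a t ∈ truncatedSimplex N (gammaParam N T) :=
  have h0 : 0 < N * T := by omega
  (ftrlPoint_spec hc (Nat.pos_of_mul_pos_right h0) (Nat.pos_of_mul_pos_left h0) t _).1

/-- Unbiasedness: the regret of round `t` against the arm `j` is the mean regret of the loss
estimates against the comparator, up to the bias of the latter. -/
theorem integral_loss_sub_le {G : SimpleGraph (Fin N)} (hc : IsCliqueCovering G c)
    (hNT : 3 ^ 11 ≤ N * T) (hl : IsCorruptedStochastic P T lTilde l μ)
    (hI : IsPlayedBy P T c l I) {t : ℕ} (ht : t ∈ Finset.Icc 1 T) (j : Fin N) :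
    Integrable (fun ω => l t ω (I t ω)) P ∧ Integrable (fun ω => l t ω j) P ∧
      Integrable (fun ω => ∑ i, lossEstimate c
        (prediction T c (fun s => l s ω) (fun s => I s ω) t) (l t ω) (I t ω) i *
        (prediction T c (fun s => l s ω) (fun s => I s ω) t i - comparator N T j i)) P ∧
      ∫ ω, l t ω (I t ω) ∂P - ∫ ω, l t ω j ∂P ≤
        ∫ ω, ∑ i, lossEstimate c
          (prediction T c (fun s => l s ω) (fun s => I s ω) t) (l t ω) (I t ω) i *
          (prediction T c (fun s => l s ω) (fun s => I s ω) t i - comparator N T j i) ∂P +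
        1 / T := by
  have hu := comparator_mem hNT j
  have hlt := hl.mem_Icc t ht
  have hp := fun ω => prediction_mem hc hNT (fun s => l s ω) (fun s => I s ω) t
  obtain ⟨a1, a2, a3⟩ := integral_draw_prediction hl hI ht (φ := fun j x => x.2 j) (C := 1)
    (fun j => by fun_prop) (fun j ω => by
      rw [abs_of_nonneg (hlt ω j).1]
      exact (hlt ω j).2)
  obtain ⟨b1, b2, b3⟩ := integral_draw_prediction hl hI ht
    (φ := fun j' x => ∑ i, lossEstimate c x.1 x.2 j' i * (x.1 i - comparator N T j i))
    (fun j' => Finset.measurable_fun_sum _ fun i _ => (measurable_lossEstimate c i j').mul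
      (((measurable_pi_apply i).comp measurable_fst).sub measurable_const))
    (fun j' ω => abs_sum_lossEstimate_le hc hNT (hp ω) hu (hlt ω) j')
  have hlj : Integrable (fun ω => l t ω j) P :=
    Integrable.of_bound ((measurable_pi_apply j).comp (hl.measurable t ht)).aestronglyMeasurable 1
      (Filter.Eventually.of_forall fun ω => by
        rw [Real.norm_eq_abs, abs_of_nonneg (hlt ω j).1]
        exact (hlt ω j).2)
  refine ⟨a1, hlj, b1, ?_⟩
  have e : ∫ ω, 1 / (T : ℝ) ∂P = 1 / T := by simp
  rw [a3, b3, ← e, ← integral_sub a2 hlj, ← integral_add b2 (integrable_const _)]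
  refine integral_mono (a2.sub hlj) (b2.add (integrable_const _)) fun ω => ?_
  simp only
  rw [sum_mul_sum_lossEstimate fun k => mass_cell_pos hc hNT (hp ω) k]
  simp only [mul_sub]
  rw [Finset.sum_sub_distrib]
  have h1 := sum_mul_comparator_le hNT (hlt ω) j
  have h2 : ∑ i, l t ω i * prediction T c (fun s => l s ω) (fun s => I s ω) t i =
      ∑ i, prediction T c (fun s => l s ω) (fun s => I s ω) t i * l t ω i :=
    Finset.sum_congr rfl fun i _ => mul_comm _ _
  linarith

/-- The mean of the pathwise bound of one round, after Jensen's inequality for the square root. -/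
theorem integral_round_bound_le {G : SimpleGraph (Fin N)} (hc : IsCliqueCovering G c)
    (hNT : 3 ^ 11 ≤ N * T) (hl : IsCorruptedStochastic P T lTilde l μ)
    (hI : IsPlayedBy P T c l I) {t : ℕ} (ht : t ∈ Finset.Icc 1 T) (iStar : Fin N) :
    Integrable (fun ω => stabilityBound c iStar √(t : ℝ)
        (prediction T c (fun s => l s ω) (fun s => I s ω) t) (I t ω) +
      ((alphaParam N T + Real.log ((N : ℝ) * T)) *
          offCliqueSum c iStar (prediction T c (fun s => l s ω) (fun s => I s ω) t) +
        (Real.log ((N : ℝ) * T) + 1) *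
          √(mass (prediction T c (fun s => l s ω) (fun s => I s ω) t)
            ((cell c (c iStar)).erase iStar))) / √(t : ℝ)) P ∧
    ∫ ω, (stabilityBound c iStar √(t : ℝ)
        (prediction T c (fun s => l s ω) (fun s => I s ω) t) (I t ω) +
      ((alphaParam N T + Real.log ((N : ℝ) * T)) *
          offCliqueSum c iStar (prediction T c (fun s => l s ω) (fun s => I s ω) t) +
        (Real.log ((N : ℝ) * T) + 1) *
          √(mass (prediction T c (fun s => l s ω) (fun s => I s ω) t)
            ((cell c (c iStar)).erase iStar))) / √(t : ℝ)) ∂P ≤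
      6 * Real.log ((N : ℝ) * T) ^ 2 * ∑ k ∈ Finset.univ.erase (c iStar),
        √((∫ ω, mass (prediction T c (fun s => l s ω) (fun s => I s ω) t) (cell c k) ∂P) / t) +
      2 * Real.log ((N : ℝ) * T) *
        √((∫ ω, mass (prediction T c (fun s => l s ω) (fun s => I s ω) t)
          ((cell c (c iStar)).erase iStar) ∂P) / t) := by
  have hL := twelve_le_log hNT
  have hα : alphaParam N T = 2 * (Real.log ((N : ℝ) * T) ^ 2 + 1) := rfl
  set L := Real.log ((N : ℝ) * T)
  have ht1 : (1 : ℝ) ≤ t := by exact_mod_cast (Finset.mem_Icc.1 ht).1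
  have hτ : 1 ≤ √(t : ℝ) := Real.one_le_sqrt.2 ht1
  have hτ0 : 0 < √(t : ℝ) := by linarith
  have hp := fun ω => prediction_mem hc hNT (fun s => l s ω) (fun s => I s ω) t
  have hmeas : ∀ {φ : (Fin N → ℝ) → ℝ}, Measurable φ → AEStronglyMeasurable
      (fun ω => φ (prediction T c (fun s => l s ω) (fun s => I s ω) t)) P := fun {φ} hφ =>
    (aestronglyMeasurable_history hI ht (φ := fun x => φ x.1) (hφ.comp measurable_fst)).mono
      (history_le hl hI ht)
  have hsqrt_int : ∀ A, Integrable (fun ω =>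
      √(mass (prediction T c (fun s => l s ω) (fun s => I s ω) t) A)) P := fun A =>
    Integrable.of_bound (hmeas (measurable_mass A).sqrt) 1 (Filter.Eventually.of_forall fun ω => by
      rw [Real.norm_eq_abs, abs_of_nonneg (Real.sqrt_nonneg _)]
      exact Real.sqrt_le_one.2 (mass_le_one (hp ω) A))
  have hjensen : ∀ A, (∫ ω, √(mass (prediction T c (fun s => l s ω) (fun s => I s ω) t) A) ∂P) /
      √(t : ℝ) ≤ √((∫ ω, mass (prediction T c (fun s => l s ω) (fun s => I s ω) t) A ∂P) / t) :=
    fun A => by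
    rw [Real.sqrt_div' _ (by linarith)]
    exact div_le_div_of_nonneg_right (integral_sqrt_le (hmeas (measurable_mass A))
      (fun ω => mass_nonneg (hp ω) A) fun ω => mass_le_one (hp ω) A) hτ0.le
  have hS_int : Integrable (fun ω =>
      offCliqueSum c iStar (prediction T c (fun s => l s ω) (fun s => I s ω) t)) P :=
    integrable_finsetSum _ fun k _ => hsqrt_int _
  have hw_int := hsqrt_int ((cell c (c iStar)).erase iStar)
  obtain ⟨b1, b2, b3⟩ := integral_draw_prediction hl hI ht
    (φ := fun j x => stabilityBound c iStar √(t : ℝ) x.1 j)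
    (fun j => (measurable_stabilityBound c iStar _ j).comp measurable_fst)
    (fun j ω => abs_stabilityBound_le hc hNT (hp ω) hτ iStar j)
  have hpen_int : Integrable (fun ω => ((alphaParam N T + L) *
          offCliqueSum c iStar (prediction T c (fun s => l s ω) (fun s => I s ω) t) +
        (L + 1) * √(mass (prediction T c (fun s => l s ω) (fun s => I s ω) t)
            ((cell c (c iStar)).erase iStar))) / √(t : ℝ)) P :=
    ((hS_int.const_mul _).add (hw_int.const_mul _)).div_const _
  have hbd_int : Integrable (fun ω => 6 * L ^ 2 *
          (offCliqueSum c iStar (prediction T c (fun s => l s ω) (fun s => I s ω) t) / √(t : ℝ)) +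
        2 * L * (√(mass (prediction T c (fun s => l s ω) (fun s => I s ω) t)
            ((cell c (c iStar)).erase iStar)) / √(t : ℝ))) P :=
    ((hS_int.div_const _).const_mul _).add ((hw_int.div_const _).const_mul _)
  refine ⟨b1.add hpen_int, ?_⟩
  rw [integral_add b1 hpen_int, b3, ← integral_add b2 hpen_int]
  calc _ ≤ ∫ ω, (6 * L ^ 2 *
          (offCliqueSum c iStar (prediction T c (fun s => l s ω) (fun s => I s ω) t) / √(t : ℝ)) +
        2 * L * (√(mass (prediction T c (fun s => l s ω) (fun s => I s ω) t)
            ((cell c (c iStar)).erase iStar)) / √(t : ℝ))) ∂P := by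
        refine integral_mono (b2.add hpen_int) hbd_int fun ω => ?_
        have h1 := sum_mul_stabilityBound_le hc hNT hτ0 (hp ω) iStar
        have hS := div_nonneg (offCliqueSum_nonneg c iStar
          (prediction T c (fun s => l s ω) (fun s => I s ω) t)) hτ0.le
        have hw := div_nonneg (Real.sqrt_nonneg
          (mass (prediction T c (fun s => l s ω) (fun s => I s ω) t)
            ((cell c (c iStar)).erase iStar))) hτ0.le
        rw [hα]
        simp only [add_div, mul_div_assoc] at h1 ⊢
        have e1 : 2 * (L ^ 2 + 1) + L + 22 ≤ 6 * L ^ 2 := by nlinarith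
        have e2 : L + 1 + 8 ≤ 2 * L := by linarith
        have f1 := mul_le_mul_of_nonneg_right e1 hS
        have f2 := mul_le_mul_of_nonneg_right e2 hw
        linarith
    _ = 6 * L ^ 2 * ∑ k ∈ Finset.univ.erase (c iStar),
          ((∫ ω, √(mass (prediction T c (fun s => l s ω) (fun s => I s ω) t) (cell c k)) ∂P) /
            √(t : ℝ)) +
        2 * L * ((∫ ω, √(mass (prediction T c (fun s => l s ω) (fun s => I s ω) t)
            ((cell c (c iStar)).erase iStar)) ∂P) / √(t : ℝ)) := by
        rw [integral_add ((hS_int.div_const _).const_mul _) ((hw_int.div_const _).const_mul _),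
          integral_const_mul, integral_const_mul, integral_div, integral_div, ← Finset.sum_div]
        unfold offCliqueSum
        rw [integral_finsetSum _ fun k _ => hsqrt_int _]
    _ ≤ _ := by
        refine add_le_add (mul_le_mul_of_nonneg_left
          (Finset.sum_le_sum fun k _ => hjensen _) (by positivity))
          (mul_le_mul_of_nonneg_left (hjensen _) (by positivity))

/-- Regret against a fixed arm `j`; the arm `iStar` with respect to which the bound is
self-bounding may be any other arm. -/
theorem regret_le {G : SimpleGraph (Fin N)} (hc : IsCliqueCovering G c)
    (hNT : 3 ^ 11 ≤ N * T) (hl : IsCorruptedStochastic P T lTilde l μ)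
    (hI : IsPlayedBy P T c l I) (iStar j : Fin N) :
    (∫ ω, ∑ t ∈ Finset.Icc 1 T, l t ω (I t ω) ∂P) - ∫ ω, ∑ t ∈ Finset.Icc 1 T, l t ω j ∂P ≤
      9 * K * Real.log ((N : ℝ) * T) +
      6 * Real.log ((N : ℝ) * T) ^ 2 *
          ∑ t ∈ Finset.Icc 1 T, ∑ k ∈ Finset.univ.erase (c iStar),
            √((∫ ω, mass (prediction T c (fun s => l s ω) (fun s => I s ω) t)
                (cell c k) ∂P) / t) +
      2 * Real.log ((N : ℝ) * T) *
          ∑ t ∈ Finset.Icc 1 T,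
            √((∫ ω, mass (prediction T c (fun s => l s ω) (fun s => I s ω) t)
                ((cell c (c iStar)).erase iStar) ∂P) / t) := by
  have hL := twelve_le_log hNT
  have hloss := fun t ht => integral_loss_sub_le hc hNT hl hI (t := t) ht j
  have hT : 0 < T := Nat.pos_of_mul_pos_left (by omega : 0 < N * T)
  rw [integral_finsetSum _ fun t ht => (hloss t ht).1,
    integral_finsetSum _ fun t ht => (hloss t ht).2.1, ← Finset.sum_sub_distrib]
  rcases Nat.lt_or_ge T 2 with hT1 | hT2
  · -- for a single round the regret is at most `1`, and the first term alone exceeds it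
    have hTeq : T = 1 := by omega
    have h1 : ∑ t ∈ Finset.Icc 1 T, (∫ ω, l t ω (I t ω) ∂P - ∫ ω, l t ω j ∂P) ≤ 1 := by
      calc _ ≤ ∑ t ∈ Finset.Icc 1 T, (1 : ℝ) := by
            refine Finset.sum_le_sum fun t ht => ?_
            have a1 : ∫ ω, l t ω (I t ω) ∂P ≤ ∫ _, (1 : ℝ) ∂P :=
              integral_mono (hloss t ht).1 (integrable_const _)
                fun ω => (hl.mem_Icc t ht ω _).2
            have a2 : 0 ≤ ∫ ω, l t ω j ∂P := integral_nonneg fun ω => (hl.mem_Icc t ht ω j).1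
            simp only [integral_const, probReal_univ, smul_eq_mul, mul_one] at a1
            linarith
        _ = 1 := by simp [hTeq]
    have hK : (1 : ℝ) ≤ K := by exact_mod_cast Fin.pos (c j)
    have h2 : 1 ≤ 9 * K * Real.log ((N : ℝ) * T) := by nlinarith
    have h3 : 0 ≤ ∑ t ∈ Finset.Icc 1 T, ∑ k ∈ Finset.univ.erase (c iStar),
            √((∫ ω, mass (prediction T c (fun s => l s ω) (fun s => I s ω) t)
                (cell c k) ∂P) / t) :=
      Finset.sum_nonneg fun _ _ => Finset.sum_nonneg fun _ _ => Real.sqrt_nonneg _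
    have h4 : 0 ≤ ∑ t ∈ Finset.Icc 1 T,
            √((∫ ω, mass (prediction T c (fun s => l s ω) (fun s => I s ω) t)
                ((cell c (c iStar)).erase iStar) ∂P) / t) :=
      Finset.sum_nonneg fun _ _ => Real.sqrt_nonneg _
    have h5 := mul_nonneg (by positivity : 0 ≤ 6 * Real.log ((N : ℝ) * T) ^ 2) h3
    have h6 := mul_nonneg (by linarith : 0 ≤ 2 * Real.log ((N : ℝ) * T)) h4
    linarith
  · have hround := fun t ht => integral_round_bound_le hc hNT hl hI (t := t) ht iStar
    have hpath := integral_mono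
      (integrable_finsetSum _ fun t ht => (hloss t ht).2.2.1)
      ((integrable_const (logBarrier 9 c (comparator N T j))).add
        (integrable_finsetSum _ fun t ht => (hround t ht).1))
      (fun ω => pathwise_regret_le hc hNT (l := fun s => l s ω) (fun s => I s ω)
        (fun t ht => hl.mem_Icc t ht ω) iStar (comparator_mem hNT j))
    rw [integral_finsetSum _ fun t ht => (hloss t ht).2.2.1] at hpath
    simp only [Pi.add_apply] at hpath
    rw [integral_add (integrable_const _) (integrable_finsetSum _ fun t ht => (hround t ht).1),
      integral_finsetSum _ fun t ht => (hround t ht).1, integral_const, probReal_univ,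
      one_smul] at hpath
    have hs1 := Finset.sum_le_sum fun t ht => (hloss t ht).2.2.2
    have hs2 := Finset.sum_le_sum fun t ht => (hround t ht).2
    rw [Finset.sum_add_distrib] at hs1
    rw [Finset.sum_add_distrib, ← Finset.mul_sum, ← Finset.mul_sum] at hs2
    have hbias : ∑ t ∈ Finset.Icc 1 T, 1 / (T : ℝ) = 1 := by
      have : (T : ℝ) ≠ 0 := by exact_mod_cast hT.ne'
      simp [this]
    rw [hbias] at hs1
    have hbar := logBarrier_comparator_add_one_le hc hNT hT2 j
    linarith

end ExpectedRegret

end GraphFTRL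

theorem mainTheorem2 {Ω : Type*} [MeasurableSpace Ω] (P : Measure Ω) [IsProbabilityMeasure P]
    (N K T : ℕ) (hNT : 3 ^ 11 ≤ N * T)
    (G : SimpleGraph (Fin N)) (c : Fin N → Fin K) (hc : GraphFTRL.IsCliqueCovering G c)
    (lTilde l : ℕ → Ω → Fin N → ℝ) (μ : Fin N → ℝ)
    (hl : GraphFTRL.IsCorruptedStochastic P T lTilde l μ)
    (iStar : Fin N) (hStar : ∀ i, i ≠ iStar → μ iStar < μ i)
    (I : ℕ → Ω → Fin N) (hI : GraphFTRL.IsPlayedBy P T c l I) :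
    GraphFTRL.pseudoRegret P T l I ≤
      9 * K * Real.log ((N : ℝ) * T)
      + 6 * Real.log ((N : ℝ) * T) ^ 2 *
          ∑ t ∈ Finset.Icc 1 T, ∑ k ∈ Finset.univ.erase (c iStar),
            √((∫ ω, GraphFTRL.mass
                (GraphFTRL.prediction T c (fun s => l s ω) (fun s => I s ω) t)
                (GraphFTRL.cell c k) ∂P) / t)
      + 2 * Real.log ((N : ℝ) * T) *
          ∑ t ∈ Finset.Icc 1 T,
            √((∫ ω, GraphFTRL.mass
                (GraphFTRL.prediction T c (fun s => l s ω) (fun s => I s ω) t)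
                ((GraphFTRL.cell c (c iStar)).erase iStar) ∂P) / t)
      + 16 *
          ∑ t ∈ Finset.Icc 1 T,
            √((∫ ω, GraphFTRL.mass
                (GraphFTRL.predictionPlus T c (fun s => l s ω) (fun s => I s ω) t)
                ((GraphFTRL.cell c (c iStar)).erase iStar) ∂P) / t) := by
  have : Nonempty (Fin N) := ⟨iStar⟩
  obtain ⟨j, hj⟩ := exists_eq_ciInf_of_finite
    (f := fun i : Fin N => ∫ ω, ∑ t ∈ Finset.Icc 1 T, l t ω i ∂P)
  have h := GraphFTRL.regret_le hc hNT hl hI iStar j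
  have hplus : 0 ≤ ∑ t ∈ Finset.Icc 1 T,
            √((∫ ω, GraphFTRL.mass
                (GraphFTRL.predictionPlus T c (fun s => l s ω) (fun s => I s ω) t)
                ((GraphFTRL.cell c (c iStar)).erase iStar) ∂P) / t) :=
    Finset.sum_nonneg fun _ _ => Real.sqrt_nonneg _
  unfold GraphFTRL.pseudoRegret
  rw [← hj]
  linarith
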